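/- **Definitions.** Write $\oplus$ and $\mathbf 0$ for the sum and the unit of a symmetric monoidal category. An *SMC-category* is a bicategory $\mathbf B$ with a symmetric monoidal structure on each category $\mathbf B(a,b)$, such that the functors $$\mathbf B(b,c)\to\mathbf{CAT}(\mathbf B(a,b),\mathbf B(a,c)),\ g\mapsto g\circ-,\qquad \mathbf B(a,b)\to\mathbf{CAT}(\mathbf B(b,c),\mathbf B(a,c)),\ f\mapsto -\circ f,$$ are equipped with symmetric strong monoidal structures (functor categories have the pointwise structure), subject to two conditions. Evaluating the two structures makes every functor $g\circ-$ and $-\circ f$ symmetric strong monoidal; (1) the isomorphisms $(g\oplus g')\circ-\cong(g\circ-)\oplus(g'\circ-)$, $-\circ(f\oplus f')\cong(-\circ f)\oplus(-\circ f')$, $\mathbf 0\circ-\cong\mathbf 0$, $-\circ\mathbf 0\cong\mathbf 0$ are isomorphisms of monoidal functors; (2) the isomorphisms $f\circ(g\circ-)\cong(f\circ g)\circ-$, $(-\circ f)\circ g\cong-\circ(f\circ g)$, $f\circ(-\circ g)\cong(f\circ-)\circ g$, $-\circ\mathbf 1\cong\mathrm{id}$, $\mathbf 1\circ-\cong\mathrm{id}$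 are isomorphisms of monoidal functors. An *SMC-functor* $F:\mathbf B\to\mathbf C$ is a pseudofunctor with symmetric strong monoidal structures on the functors $F:\mathbf B(a,b)\to\mathbf C(Fa,Fb)$ such that the comparison $F(g\circ f)\cong Fg\circ Ff$ is a monoidal transformation in each variable. A *monoidal transformation* $\eta:F\Rightarrow G$ of SMC-functors is a strong (pseudonatural) transformation whose constraint $\eta_b\circ Ff\cong Gf\circ\eta_a$ is, for all $a,b$, a monoidal transformation of functors of $f\in\mathbf B(a,b)$. SMC-functors $\mathbf B\to\mathbf C$, monoidal transformations and (all) modifications form a bicategory $\mathbf{SMC\text{-}Cat}(\mathbf B,\mathbf C)$. A *biequivalence* of SMC-categories from $\mathbf B$ to $\mathbf C$ is a pair of SMC-functors $F:\mathbf B\rightleftarrows\mathbf C:G$ with an equivalence $FG\simeq 1_{\mathbf C}$ in $\mathbf{SMC\text{-}Cat}(\mathbf C,\mathbf C)$ and an equivalence $1_{\mathbf B}\simeq GF$ in $\mathbf{SMC\text{-}Cat}(\mathbf B,\mathbf B)$; an SMC-functor $F$ is a biequivalence if it is part of such a pair with such equivalences. Let $\mathbf{SymMon}$ be the SMC-category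 of symmetric monoidal categories (with objects and morphisms in fixed universes), symmetric strong monoidal functors, and monoidal transformations. Sums of functors are pointwise, $(F\oplus G)(c)=F(c)\oplus G(c)$, with structure morphism $$(F(c)\oplus G(c))\oplus(F(d)\oplus G(d))\cong(F(c)\oplus F(d))\oplus(G(c)\oplus G(d))\cong F(c\oplus d)\oplus G(c\oplus d),$$ and the zero functor is constant at the unit. Let $\mathbf{Perm}_u$ be the locally full sub-SMC-category of $\mathbf{SymMon}$ whose $0$-cells are the permutative (that is, symmetric strict monoidal) categories and whose $1$-cells are the symmetric strong monoidal functors $F$ that are strictly unital: $F(\mathbf 0)=\mathbf 0$, with the identity as unit constraint. **Corollary.** The inclusion SMC-functor $\mathbf{Perm}_u\hookrightarrow\mathbf{SymMon}$ (the identity on all cells of $\mathbf{Perm}_u$, with identity constraints) is a biequivalence of SMC-categories. -/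

import Mathlib

open CategoryTheory

/-!
`SMC`-categories (bicategories whose hom-categories are symmetric monoidal and whose composition is
bilinear), `SMC`-functors, monoidal transformations, biequivalences, and the `SMC`-categories of
symmetric monoidal categories and of permutative categories.

All compositions are written diagrammatically: `f ≫ g` is the composite `g ∘ f`. The sum `⊕` in a
symmetric monoidal category is written `⊗`, its unit `𝟙_`, and the constraints of a strong monoidal
functor `F` are `ε F : 𝟙_ ⟶ F 𝟙_` and `μ F x y : F x ⊗ F y ⟶ F (x ⊗ y)`. `Functor.Braided` is the
structure of a symmetric strong monoidal functor when the categories are symmetric.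
-/

namespace SMC

set_option linter.unusedVariables false
set_option linter.checkUnivs false

universe w w' w'' v v' v'' u u' u''

/-!
### Sums of symmetric strong monoidal functors

The functor category `C ⥤ D` has the pointwise monoidal structure, `(F ⊗ G) x = F x ⊗ G x`, with unit
the constant functor at `𝟙_ D`. Here the sum of two symmetric strong monoidal functors, and the
constant functor at the unit, are made into symmetric strong monoidal functors.
-/

section FunctorSums

open MonoidalCategory Functor Functor.LaxMonoidal Functor.OplaxMonoidal Functor.Monoidal

variable {C : Type u} [Category.{v} C] [MonoidalCategory C]
  {D : Type u'} [Category.{v'} D] [MonoidalCategory D]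

theorem tensorμ_braiding [SymmetricCategory D] (X₁ X₂ Y₁ Y₂ : D) :
    tensorμ X₁ X₂ Y₁ Y₂ ≫ ((β_ X₁ Y₁).hom ⊗ₘ (β_ X₂ Y₂).hom) =
      (β_ (X₁ ⊗ X₂) (Y₁ ⊗ Y₂)).hom ≫ tensorμ Y₁ Y₂ X₁ X₂ := by
  have h₁ : (β_ X₁ Y₂).hom ≫ (β_ Y₂ X₁).hom = 𝟙 _ := SymmetricCategory.symmetry _ _
  have h₂ : (β_ Y₂ X₁).hom = (β_ X₁ Y₂).inv := by
    rw [← cancel_epi (β_ X₁ Y₂).hom, h₁, Iso.hom_inv_id]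
  simp [tensorμ, MonoidalCategory.tensorHom_def, h₂]

theorem tensorμ_braiding' [SymmetricCategory D] (X₁ X₂ Y₁ Y₂ : D) :
    tensorμ X₁ X₂ Y₁ Y₂ ≫ (β_ (X₁ ⊗ Y₁) (X₂ ⊗ Y₂)).hom =
      ((β_ X₁ X₂).hom ⊗ₘ (β_ Y₁ Y₂).hom) ≫ tensorμ X₂ X₁ Y₂ Y₁ := by
  have h₁ : (β_ X₂ Y₁).hom ≫ (β_ Y₁ X₂).hom = 𝟙 _ := SymmetricCategory.symmetry _ _
  have h₂ : (β_ Y₁ X₂).hom = (β_ X₂ Y₁).inv := by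
    rw [← cancel_epi (β_ X₂ Y₁).hom, h₁, Iso.hom_inv_id]
  simp [tensorμ, MonoidalCategory.tensorHom_def, h₂]

/-- The unit constraint of `F ⊗ G`. -/
@[simps]
def sumεIso (F G : C ⥤ D) [F.Monoidal] [G.Monoidal] :
    𝟙_ D ≅ F.obj (𝟙_ C) ⊗ G.obj (𝟙_ C) where
  hom := (λ_ (𝟙_ D)).inv ≫ (ε F ⊗ₘ ε G)
  inv := (η F ⊗ₘ η G) ≫ (λ_ (𝟙_ D)).hom

/-- The structure morphism of `F ⊗ G`: exchange the two middle summands, then apply those of `F`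
and `G`. -/
@[simps]
def sumμIso [BraidedCategory D] (F G : C ⥤ D) [F.Monoidal] [G.Monoidal] (X Y : C) :
    (F.obj X ⊗ G.obj X) ⊗ (F.obj Y ⊗ G.obj Y) ≅ F.obj (X ⊗ Y) ⊗ G.obj (X ⊗ Y) where
  hom := tensorμ (F.obj X) (G.obj X) (F.obj Y) (G.obj Y) ≫ (μ F X Y ⊗ₘ μ G X Y)
  inv := (δ F X Y ⊗ₘ δ G X Y) ≫ tensorδ (F.obj X) (G.obj X) (F.obj Y) (G.obj Y)

/-- The pointwise sum of two strong monoidal functors is strong monoidal. -/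
def sumMonoidal [BraidedCategory D] (F G : C ⥤ D) [F.Monoidal] [G.Monoidal] :
    (F ⊗ G).CoreMonoidal where
  εIso := sumεIso F G
  μIso X Y := sumμIso F G X Y
  μIso_hom_natural_left {X Y} f Z := by
    change (F.map f ⊗ₘ G.map f) ▷ (F.obj Z ⊗ G.obj Z) ≫ tensorμ _ _ _ _ ≫ (μ F Y Z ⊗ₘ μ G Y Z) =
      (tensorμ _ _ _ _ ≫ (μ F X Z ⊗ₘ μ G X Z)) ≫ (F.map (f ▷ Z) ⊗ₘ G.map (f ▷ Z))
    rw [tensorμ_natural_left_assoc, Category.assoc, tensorHom_comp_tensorHom,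
      tensorHom_comp_tensorHom, μ_natural_left, μ_natural_left]
  μIso_hom_natural_right {X Y} Z f := by
    change (F.obj Z ⊗ G.obj Z) ◁ (F.map f ⊗ₘ G.map f) ≫ tensorμ _ _ _ _ ≫ (μ F Z Y ⊗ₘ μ G Z Y) =
      (tensorμ _ _ _ _ ≫ (μ F Z X ⊗ₘ μ G Z X)) ≫ (F.map (Z ◁ f) ⊗ₘ G.map (Z ◁ f))
    rw [tensorμ_natural_right_assoc, Category.assoc, tensorHom_comp_tensorHom,
      tensorHom_comp_tensorHom, μ_natural_right, μ_natural_right]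
  associativity X Y Z := by
    have h := tensor_associativity (F.obj X) (G.obj X) (F.obj Y) (G.obj Y) (F.obj Z) (G.obj Z)
    change (tensorμ _ _ _ _ ≫ (μ F X Y ⊗ₘ μ G X Y)) ▷ (F.obj Z ⊗ G.obj Z) ≫
        (tensorμ _ _ _ _ ≫ (μ F (X ⊗ Y) Z ⊗ₘ μ G (X ⊗ Y) Z)) ≫
          (F.map (α_ X Y Z).hom ⊗ₘ G.map (α_ X Y Z).hom) =
      (α_ (F.obj X ⊗ G.obj X) (F.obj Y ⊗ G.obj Y) (F.obj Z ⊗ G.obj Z)).hom ≫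
        (F.obj X ⊗ G.obj X) ◁ (tensorμ _ _ _ _ ≫ (μ F Y Z ⊗ₘ μ G Y Z)) ≫
          tensorμ _ _ _ _ ≫ (μ F X (Y ⊗ Z) ⊗ₘ μ G X (Y ⊗ Z))
    rw [MonoidalCategory.comp_whiskerRight, Category.assoc, Category.assoc,
      tensorμ_natural_left_assoc, tensorHom_comp_tensorHom, tensorHom_comp_tensorHom,
      LaxMonoidal.associativity, LaxMonoidal.associativity, ← tensorHom_comp_tensorHom,
      reassoc_of% h, ← tensorHom_comp_tensorHom, MonoidalCategory.whiskerLeft_comp, Category.assoc,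
      tensorμ_natural_right_assoc]
  left_unitality X := by
    have h := tensor_left_unitality (F.obj X) (G.obj X)
    change (λ_ (F.obj X ⊗ G.obj X)).hom =
      ((λ_ (𝟙_ D)).inv ≫ (ε F ⊗ₘ ε G)) ▷ (F.obj X ⊗ G.obj X) ≫
        (tensorμ _ _ _ _ ≫ (μ F (𝟙_ C) X ⊗ₘ μ G (𝟙_ C) X)) ≫
          (F.map (λ_ X).hom ⊗ₘ G.map (λ_ X).hom)
    rw [MonoidalCategory.comp_whiskerRight, Category.assoc, Category.assoc,
      tensorμ_natural_left_assoc, tensorHom_comp_tensorHom, tensorHom_comp_tensorHom,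
      ← LaxMonoidal.left_unitality, ← LaxMonoidal.left_unitality, h]
  right_unitality X := by
    have h := tensor_right_unitality (F.obj X) (G.obj X)
    change (ρ_ (F.obj X ⊗ G.obj X)).hom =
      (F.obj X ⊗ G.obj X) ◁ ((λ_ (𝟙_ D)).inv ≫ (ε F ⊗ₘ ε G)) ≫
        (tensorμ _ _ _ _ ≫ (μ F X (𝟙_ C) ⊗ₘ μ G X (𝟙_ C))) ≫
          (F.map (ρ_ X).hom ⊗ₘ G.map (ρ_ X).hom)
    rw [MonoidalCategory.whiskerLeft_comp, Category.assoc, Category.assoc,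
      tensorμ_natural_right_assoc, tensorHom_comp_tensorHom, tensorHom_comp_tensorHom,
      ← LaxMonoidal.right_unitality, ← LaxMonoidal.right_unitality, h]

/-- The pointwise sum of two symmetric strong monoidal functors is symmetric strong monoidal. -/
instance sumBraided [BraidedCategory C] [SymmetricCategory D] (F G : C ⥤ D)
    [F.Braided] [G.Braided] : (F ⊗ G).Braided where
  toMonoidal := (sumMonoidal F G).toMonoidal
  braided X Y := by
    change (tensorμ _ _ _ _ ≫ (μ F X Y ⊗ₘ μ G X Y)) ≫ (F.map (β_ X Y).hom ⊗ₘ G.map (β_ X Y).hom) =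
      (β_ (F.obj X ⊗ G.obj X) (F.obj Y ⊗ G.obj Y)).hom ≫ tensorμ _ _ _ _ ≫
        (μ F Y X ⊗ₘ μ G Y X)
    rw [Category.assoc, tensorHom_comp_tensorHom, Functor.LaxBraided.braided,
      Functor.LaxBraided.braided, ← tensorHom_comp_tensorHom, reassoc_of% tensorμ_braiding]

/-- The constant functor at the unit is strong monoidal. -/
def zeroMonoidal : (𝟙_ (C ⥤ D)).CoreMonoidal where
  εIso := Iso.refl _
  μIso X Y := λ_ (𝟙_ D)
  associativity X Y Z := by
    dsimp
    simp only [unitors_equal, Category.comp_id]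
    monoidal
  right_unitality X := by
    dsimp
    simp only [unitors_equal, Category.comp_id, MonoidalCategory.whiskerLeft_id, Category.id_comp]

/-- The constant functor at the unit is symmetric strong monoidal. -/
instance zeroBraided [BraidedCategory C] [BraidedCategory D] : (𝟙_ (C ⥤ D)).Braided where
  toMonoidal := zeroMonoidal.toMonoidal
  braided X Y := by
    change (λ_ (𝟙_ D)).hom ≫ 𝟙 _ = (β_ (𝟙_ D) (𝟙_ D)).hom ≫ (λ_ (𝟙_ D)).hom
    simp [← unitors_equal]

end FunctorSums

section Eval

open MonoidalCategory Functor Functor.LaxMonoidal Functor.OplaxMonoidal Functor.Monoidal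

variable {A : Type u} [Category.{v} A] [MonoidalCategory A]
  {B : Type u'} [Category.{v'} B]
  {D : Type u''} [Category.{v''} D] [MonoidalCategory D]

/-- If `Φ` is a strong monoidal functor into a functor category (with pointwise tensor product),
then for each `b` the functor `x ↦ (Φ x) b` is strong monoidal. -/
def evalMonoidal (Φ : A ⥤ B ⥤ D) [Φ.Monoidal] (b : B) : (Φ.flip.obj b).CoreMonoidal where
  εIso := (εIso Φ).app b
  μIso x y := (μIso Φ x y).app b
  μIso_hom_natural_left f z := NatTrans.congr_app (μ_natural_left Φ f z) b
  μIso_hom_natural_right z f := NatTrans.congr_app (μ_natural_right Φ z f) b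
  associativity x y z := NatTrans.congr_app (LaxMonoidal.associativity Φ x y z) b
  left_unitality x := NatTrans.congr_app (LaxMonoidal.left_unitality Φ x) b
  right_unitality x := NatTrans.congr_app (LaxMonoidal.right_unitality Φ x) b

/-- If `Φ` is a symmetric strong monoidal functor into a functor category (with pointwise tensor
product), then for each `b` the functor `x ↦ (Φ x) b` is symmetric strong monoidal. -/
@[reducible]
def evalBraided [BraidedCategory A] [BraidedCategory D] (Φ : A ⥤ B ⥤ D) [Φ.Braided] (b : B) :
    (Φ.flip.obj b).Braided where
  toMonoidal := (evalMonoidal Φ b).toMonoidal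
  braided x y := NatTrans.congr_app (LaxBraided.braided (F := Φ) x y) b

end Eval

/-!
### `SMC`-categories
-/

section SMCategory

open MonoidalCategory Functor.LaxMonoidal
open CategoryTheory.Bicategory (precomposing postcomposing associatorNatIsoLeft
  associatorNatIsoMiddle associatorNatIsoRight leftUnitorNatIso rightUnitorNatIso)

/-- The data of an `SMC`-category on a bicategory `B`: a symmetric monoidal structure on each
hom-category, and symmetric strong monoidal structures on the two adjoints of composition,
`precomposing a b c : f ↦ (f ≫ -)` from `a ⟶ b` to `(b ⟶ c) ⥤ (a ⟶ c)` and
`postcomposing a b c : g ↦ (- ≫ g)` from `b ⟶ c` to `(a ⟶ b) ⥤ (a ⟶ c)`, where the functor categories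
carry the pointwise monoidal structures inherited from `a ⟶ c`. -/
class BilinearComposition (B : Type u) [Bicategory.{w, v} B] where
  homMonoidal (a b : B) : MonoidalCategory (a ⟶ b)
  homSymmetric (a b : B) : SymmetricCategory (a ⟶ b)
  precomposingBraided (a b c : B) : (precomposing a b c).Braided
  postcomposingBraided (a b c : B) : (postcomposing a b c).Braided

attribute [reducible, instance] BilinearComposition.homMonoidal BilinearComposition.homSymmetric
  BilinearComposition.precomposingBraided BilinearComposition.postcomposingBraided

section

variable {B : Type u} [Bicategory.{w, v} B] [BilinearComposition B]

/-- For a 1-cell `f : a ⟶ b`, the functor `f ≫ -` is symmetric strong monoidal: its constraints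
`f ≫ g ⊗ f ≫ g' ≅ f ≫ (g ⊗ g')` and `𝟙_ ≅ f ≫ 𝟙_` are the components at `f` of those of
`postcomposing a b c`. -/
instance precompBraided {a b : B} (c : B) (f : a ⟶ b) : ((precomposing a b c).obj f).Braided :=
  evalBraided (postcomposing a b c) f

/-- For a 1-cell `g : b ⟶ c`, the functor `- ≫ g` is symmetric strong monoidal: its constraints
`f ≫ g ⊗ f' ≫ g ≅ (f ⊗ f') ≫ g` and `𝟙_ ≅ 𝟙_ ≫ g` are the components at `g` of those of
`precomposing a b c`. -/
instance postcompBraided (a : B) {b c : B} (g : b ⟶ c) : ((postcomposing a b c).obj g).Braided :=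
  evalBraided (precomposing a b c) g

end

/-- An `SMC`-category. In addition to the data of `BilinearComposition`:
* the isomorphisms `f ≫ - ⊗ f' ≫ - ≅ (f ⊗ f') ≫ -`, `- ≫ g ⊗ - ≫ g' ≅ - ≫ (g ⊗ g')`,
  `𝟙_ ≅ 𝟙_ ≫ -` and `𝟙_ ≅ - ≫ 𝟙_` are isomorphisms of monoidal functors (first four fields; sums
  and the zero of monoidal functors are monoidal as in `sumBraided` and `zeroBraided`);
* the isomorphisms `(- ≫ g) ≫ h ≅ - ≫ (g ≫ h)`, `(f ≫ -) ≫ h ≅ f ≫ (- ≫ h)`,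
  `(f ≫ g) ≫ - ≅ f ≫ (g ≫ -)`, `𝟙 a ≫ - ≅ id` and `- ≫ 𝟙 b ≅ id` are isomorphisms of monoidal
  functors (last five fields). -/
class SMCategory (B : Type u) [Bicategory.{w, v} B] extends BilinearComposition B where
  isMonoidal_precomposing_μ {a b : B} (c : B) (f f' : a ⟶ b) :
    NatTrans.IsMonoidal (μ (precomposing a b c) f f')
  isMonoidal_postcomposing_μ (a : B) {b c : B} (g g' : b ⟶ c) :
    NatTrans.IsMonoidal (μ (postcomposing a b c) g g')
  isMonoidal_precomposing_ε (a b c : B) : NatTrans.IsMonoidal (ε (precomposing a b c))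
  isMonoidal_postcomposing_ε (a b c : B) : NatTrans.IsMonoidal (ε (postcomposing a b c))
  isMonoidal_associator_left (a : B) {b c d : B} (g : b ⟶ c) (h : c ⟶ d) :
    NatTrans.IsMonoidal (associatorNatIsoLeft a g h).hom
  isMonoidal_associator_middle {a b c d : B} (f : a ⟶ b) (h : c ⟶ d) :
    NatTrans.IsMonoidal (associatorNatIsoMiddle f h).hom
  isMonoidal_associator_right {a b c : B} (f : a ⟶ b) (g : b ⟶ c) (d : B) :
    NatTrans.IsMonoidal (associatorNatIsoRight f g d).hom
  isMonoidal_leftUnitor (a b : B) : NatTrans.IsMonoidal (leftUnitorNatIso a b).hom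
  isMonoidal_rightUnitor (a b : B) : NatTrans.IsMonoidal (rightUnitorNatIso a b).hom

end SMCategory

/-!
### `SMC`-functors
-/

section SMCFunctor

open MonoidalCategory Functor.LaxMonoidal
open CategoryTheory.Bicategory (precomposing postcomposing)

variable {B : Type u} [Bicategory.{w, v} B] {C : Type u'} [Bicategory.{w', v'} C]
  {D : Type u''} [Bicategory.{w'', v''} D]

/-- The comparison `F (f ≫ g) ≅ F f ≫ F g`, natural in `g`. -/
def precompMapIso (F : Pseudofunctor B C) {a b : B} (f : a ⟶ b) (c : B) :
    (precomposing a b c).obj f ⋙ F.mapFunctor a c ≅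
      F.mapFunctor b c ⋙ (precomposing (F.obj a) (F.obj b) (F.obj c)).obj (F.map f) :=
  NatIso.ofComponents (fun g => F.mapComp f g) (fun {g g'} η => by
    change F.map₂ (Bicategory.whiskerLeft f η) ≫ (F.mapComp f g').hom =
      (F.mapComp f g).hom ≫ Bicategory.whiskerLeft (F.map f) (F.map₂ η)
    simp)

/-- The comparison `F (f ≫ g) ≅ F f ≫ F g`, natural in `f`. -/
def postcompMapIso (F : Pseudofunctor B C) (a : B) {b c : B} (g : b ⟶ c) :
    (postcomposing a b c).obj g ⋙ F.mapFunctor a c ≅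
      F.mapFunctor a b ⋙ (postcomposing (F.obj a) (F.obj b) (F.obj c)).obj (F.map g) :=
  NatIso.ofComponents (fun f => F.mapComp f g) (fun {f f'} η => by
    change F.map₂ (Bicategory.whiskerRight η g) ≫ (F.mapComp f' g).hom =
      (F.mapComp f g).hom ≫ Bicategory.whiskerRight (F.map₂ η) (F.map g)
    simp)

/-- An `SMC`-functor: a pseudofunctor with symmetric strong monoidal structures on the functors
`(a ⟶ b) ⥤ (F a ⟶ F b)` such that the comparison `F (f ≫ g) ≅ F f ≫ F g` is a monoidal
transformation in each of the variables `f` and `g`. -/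
structure SMCFunctor (B : Type u) [Bicategory.{w, v} B] [SMCategory B]
    (C : Type u') [Bicategory.{w', v'} C] [SMCategory C] where
  toPseudofunctor : Pseudofunctor B C
  braided (a b : B) : (toPseudofunctor.mapFunctor a b).Braided
  isMonoidal_precomp {a b : B} (f : a ⟶ b) (c : B) :
    NatTrans.IsMonoidal (precompMapIso toPseudofunctor f c).hom
  isMonoidal_postcomp (a : B) {b c : B} (g : b ⟶ c) :
    NatTrans.IsMonoidal (postcompMapIso toPseudofunctor a g).hom

attribute [instance] SMCFunctor.braided
attribute [instance] SMCFunctor.isMonoidal_precomp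
  SMCFunctor.isMonoidal_postcomp

variable [SMCategory B] [SMCategory C] [SMCategory D]

/-- A transformation with the components of a monoidal one is monoidal. -/
theorem isMonoidal_of_app {C : Type u} [Category.{v} C] [MonoidalCategory C]
    {D : Type u'} [Category.{v'} D] [MonoidalCategory D] {F : C ⥤ D} {G : C ⥤ D}
    [F.LaxMonoidal] [G.LaxMonoidal] (τ τ' : F ⟶ G) [h : NatTrans.IsMonoidal τ']
    (e : ∀ x, τ.app x = τ'.app x) : NatTrans.IsMonoidal τ := by
  have : τ = τ' := NatTrans.ext (funext e)
  rwa [this]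

/-- Pasting of two squares filled with monoidal transformations. -/
theorem isMonoidal_paste {C₁ : Type*} [Category* C₁] [MonoidalCategory C₁]
    {C₂ : Type*} [Category* C₂] [MonoidalCategory C₂]
    {C₃ : Type*} [Category* C₃] [MonoidalCategory C₃]
    {D₁ : Type*} [Category* D₁] [MonoidalCategory D₁]
    {D₂ : Type*} [Category* D₂] [MonoidalCategory D₂]
    {D₃ : Type*} [Category* D₃] [MonoidalCategory D₃]
    {P : C₁ ⥤ D₁} {P' : C₂ ⥤ D₂} {P'' : C₃ ⥤ D₃} {F₁ : C₁ ⥤ C₂} {F₂ : D₁ ⥤ D₂}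
    {G₁ : C₂ ⥤ C₃} {G₂ : D₂ ⥤ D₃}
    [P.LaxMonoidal] [P'.LaxMonoidal] [P''.LaxMonoidal] [F₁.LaxMonoidal] [F₂.LaxMonoidal]
    [G₁.LaxMonoidal] [G₂.LaxMonoidal]
    (α : P ⋙ F₂ ⟶ F₁ ⋙ P') (β : P' ⋙ G₂ ⟶ G₁ ⋙ P'')
    [NatTrans.IsMonoidal α] [NatTrans.IsMonoidal β]
    (τ : P ⋙ F₂ ⋙ G₂ ⟶ (F₁ ⋙ G₁) ⋙ P'')
    (h : ∀ x, τ.app x = G₂.map (α.app x) ≫ β.app (F₁.obj x)) : NatTrans.IsMonoidal τ :=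
  isMonoidal_of_app τ ((Functor.associator P F₂ G₂).inv ≫ Functor.whiskerRight α G₂ ≫
      (Functor.associator F₁ P' G₂).hom ≫ Functor.whiskerLeft F₁ β ≫
      (Functor.associator F₁ G₁ P'').inv) (fun x => by simp [h])

/-- A vertical pasting of monoidal transformations. -/
theorem isMonoidal_paste₃
    {A : Type*} [Category* A] [MonoidalCategory A]
    {X : Type*} [Category* X] [MonoidalCategory X]
    {Y : Type*} [Category* Y] [MonoidalCategory Y]
    {Z : Type*} [Category* Z] [MonoidalCategory Z]
    {W₁ : Type*} [Category* W₁] [MonoidalCategory W₁]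
    {W₂ : Type*} [Category* W₂] [MonoidalCategory W₂]
    {V : Type*} [Category* V] [MonoidalCategory V]
    {F : A ⥤ X} {G : A ⥤ Y} {H : A ⥤ Z} {P : X ⥤ W₁} {P' : Y ⥤ W₁} {Q : W₁ ⥤ V}
    {Q' : Y ⥤ W₂} {R : W₂ ⥤ V} {S : Z ⥤ W₂} {K : X ⥤ V} {L : Z ⥤ V}
    [F.LaxMonoidal] [G.LaxMonoidal] [H.LaxMonoidal] [P.LaxMonoidal] [P'.LaxMonoidal]
    [Q.LaxMonoidal] [Q'.LaxMonoidal] [R.LaxMonoidal] [S.LaxMonoidal] [K.LaxMonoidal]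
    [L.LaxMonoidal]
    (a : K ⟶ P ⋙ Q) (α : F ⋙ P ⟶ G ⋙ P') (b : P' ⋙ Q ⟶ Q' ⋙ R) (β : G ⋙ Q' ⟶ H ⋙ S)
    (c : S ⋙ R ⟶ L)
    [NatTrans.IsMonoidal a] [NatTrans.IsMonoidal α] [NatTrans.IsMonoidal b]
    [NatTrans.IsMonoidal β] [NatTrans.IsMonoidal c]
    (τ : F ⋙ K ⟶ H ⋙ L)
    (h : ∀ x, τ.app x = a.app (F.obj x) ≫ Q.map (α.app x) ≫ b.app (G.obj x) ≫
      R.map (β.app x) ≫ c.app (H.obj x)) : NatTrans.IsMonoidal τ :=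
  isMonoidal_of_app τ (Functor.whiskerLeft F a ≫ (Functor.associator F P Q).inv ≫
      Functor.whiskerRight α Q ≫ (Functor.associator G P' Q).hom ≫
      Functor.whiskerLeft G b ≫ (Functor.associator G Q' R).inv ≫
      Functor.whiskerRight β R ≫ (Functor.associator H S R).hom ≫
      Functor.whiskerLeft H c) (fun x => by simp [h])

instance idBraided (B : Type u) [Bicategory.{w, v} B] [SMCategory B] (a b : B) :
    ((Pseudofunctor.id B).mapFunctor a b).Braided :=
  (inferInstance : (𝟭 (a ⟶ b)).Braided)

instance compBraided (F : SMCFunctor B C) (G : SMCFunctor C D) (a b : B) :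
    ((F.toPseudofunctor.comp G.toPseudofunctor).mapFunctor a b).Braided :=
  (inferInstance : (F.toPseudofunctor.mapFunctor a b ⋙ G.toPseudofunctor.mapFunctor _ _).Braided)

/-- The identity `SMC`-functor. -/
def SMCFunctor.id (B : Type u) [Bicategory.{w, v} B] [SMCategory B] : SMCFunctor B B where
  toPseudofunctor := Pseudofunctor.id B
  braided a b := idBraided B a b
  isMonoidal_precomp {a b} f c :=
    let P : (b ⟶ c) ⥤ (a ⟶ c) := (precomposing a b c).obj f
    have h : NatTrans.IsMonoidal (P.rightUnitor.hom ≫ P.leftUnitor.inv) := inferInstance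
    isMonoidal_of_app _ _ (h := h) (fun _ => (Category.id_comp _).symm)
  isMonoidal_postcomp a b c g :=
    let P : (a ⟶ b) ⥤ (a ⟶ c) := (postcomposing a b c).obj g
    have h : NatTrans.IsMonoidal (P.rightUnitor.hom ≫ P.leftUnitor.inv) := inferInstance
    isMonoidal_of_app _ _ (h := h) (fun _ => (Category.id_comp _).symm)

/-- The composite `SMC`-functor: first `F`, then `G`. -/
def SMCFunctor.comp (F : SMCFunctor B C) (G : SMCFunctor C D) : SMCFunctor B D where
  toPseudofunctor := F.toPseudofunctor.comp G.toPseudofunctor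
  braided a b := compBraided F G a b
  isMonoidal_precomp {a b} f c :=
    isMonoidal_paste (precompMapIso F.toPseudofunctor f c).hom
      (precompMapIso G.toPseudofunctor (F.toPseudofunctor.map f) _).hom _ (fun _ => rfl)
  isMonoidal_postcomp a b c g :=
    isMonoidal_paste (postcompMapIso F.toPseudofunctor a g).hom
      (postcompMapIso G.toPseudofunctor _ (F.toPseudofunctor.map g)).hom _ (fun _ => rfl)

end SMCFunctor

/-!
### The bicategory of `SMC`-functors from `B` to `C`
-/

section SMCat

open MonoidalCategory Functor.LaxMonoidal
open CategoryTheory.Bicategory (precomposing postcomposing associatorNatIsoLeft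
  associatorNatIsoMiddle associatorNatIsoRight leftUnitorNatIso rightUnitorNatIso)
open scoped Pseudofunctor.StrongTrans

variable {B : Type u} [Bicategory.{w, v} B] {C : Type u'} [Bicategory.{w', v'} C]

/-- The naturality constraint `F f ≫ η_b ≅ η_a ≫ G f` of a strong transformation `η`, natural in
`f : a ⟶ b`. -/
def strongTransIso {F G : Pseudofunctor B C} (η : F ⟶ G) (a b : B) :
    F.mapFunctor a b ⋙ (postcomposing (F.obj a) (F.obj b) (G.obj b)).obj (η.app b) ≅
      G.mapFunctor a b ⋙ (precomposing (F.obj a) (G.obj a) (G.obj b)).obj (η.app a) :=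
  NatIso.ofComponents (fun f => η.naturality f) (fun {_ _} α => η.naturality_naturality α)

variable [SMCategory B] [SMCategory C]

/-- A (strong) monoidal transformation of `SMC`-functors: a strong transformation of the underlying
pseudofunctors such that for all `a`, `b` the natural transformation `F f ≫ η_b ≅ η_a ≫ G f`, of
functors of `f : a ⟶ b`, is monoidal. -/
structure MonoidalTrans (F G : SMCFunctor B C) where
  toStrongTrans : F.toPseudofunctor ⟶ G.toPseudofunctor
  isMonoidal (a b : B) : NatTrans.IsMonoidal (strongTransIso toStrongTrans a b).hom

attribute [instance] MonoidalTrans.isMonoidal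
attribute [instance] SMCategory.isMonoidal_precomposing_μ SMCategory.isMonoidal_postcomposing_μ
  SMCategory.isMonoidal_precomposing_ε SMCategory.isMonoidal_postcomposing_ε
  SMCategory.isMonoidal_associator_left SMCategory.isMonoidal_associator_middle
  SMCategory.isMonoidal_associator_right SMCategory.isMonoidal_leftUnitor
  SMCategory.isMonoidal_rightUnitor

/-- The identity monoidal transformation. -/
def MonoidalTrans.id (F : SMCFunctor B C) : MonoidalTrans F F where
  toStrongTrans := 𝟙 F.toPseudofunctor
  isMonoidal a b :=
    let M := F.toPseudofunctor.mapFunctor a b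
    have h : NatTrans.IsMonoidal (Functor.whiskerLeft M (rightUnitorNatIso _ _).hom ≫
      Functor.whiskerLeft M (leftUnitorNatIso _ _).inv) := inferInstance
    isMonoidal_of_app _ _ (h := h) (fun _ => rfl)

/-- Composition of monoidal transformations: first `η`, then `θ`. -/
def MonoidalTrans.comp {F G H : SMCFunctor B C} (η : MonoidalTrans F G) (θ : MonoidalTrans G H) :
    MonoidalTrans F H where
  toStrongTrans := η.toStrongTrans ≫ θ.toStrongTrans
  isMonoidal a b :=
    isMonoidal_paste₃
      (associatorNatIsoLeft _ (η.toStrongTrans.app b) (θ.toStrongTrans.app b)).inv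
      (strongTransIso η.toStrongTrans a b).hom
      (associatorNatIsoMiddle (η.toStrongTrans.app a) (θ.toStrongTrans.app b)).hom
      (strongTransIso θ.toStrongTrans a b).hom
      (associatorNatIsoRight (η.toStrongTrans.app a) (θ.toStrongTrans.app a) _).inv _
      (fun x => Pseudofunctor.StrongTrans.categoryStruct_comp_naturality_hom η.toStrongTrans θ.toStrongTrans x)

/-- The morphisms between monoidal transformations are all modifications. -/
instance homCat (F G : SMCFunctor B C) : Category (MonoidalTrans F G) where
  Hom η θ := η.toStrongTrans ⟶ θ.toStrongTrans
  id η := 𝟙 η.toStrongTrans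
  comp Γ Δ := Γ ≫ Δ
  id_comp Γ := Category.id_comp (obj := F.toPseudofunctor ⟶ G.toPseudofunctor) Γ
  comp_id Γ := Category.comp_id (obj := F.toPseudofunctor ⟶ G.toPseudofunctor) Γ
  assoc Γ Δ E := Category.assoc (obj := F.toPseudofunctor ⟶ G.toPseudofunctor) Γ Δ E

/-- An invertible modification. -/
@[simps]
def modIsoMk {F G : SMCFunctor B C} {η θ : MonoidalTrans F G}
    (e : η.toStrongTrans ≅ θ.toStrongTrans) : η ≅ θ where
  hom := e.hom
  inv := e.inv
  hom_inv_id := e.hom_inv_id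
  inv_hom_id := e.inv_hom_id

/-- The bicategory of `SMC`-functors `B → C`, monoidal transformations and modifications. All its
structure is that of the bicategory of pseudofunctors, strong transformations and modifications. -/
instance : Bicategory (SMCFunctor B C) where
  Hom F G := MonoidalTrans F G
  id F := MonoidalTrans.id F
  comp η θ := MonoidalTrans.comp η θ
  homCategory F G := homCat F G
  whiskerLeft η _ _ Γ := Bicategory.whiskerLeft η.toStrongTrans Γ
  whiskerRight {_ _ _ η η'} Γ θ := Bicategory.whiskerRight (f := η.toStrongTrans) (g := η'.toStrongTrans) Γ θ.toStrongTrans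
  associator η θ ι :=
    modIsoMk (Bicategory.associator η.toStrongTrans θ.toStrongTrans ι.toStrongTrans)
  leftUnitor η := modIsoMk (Bicategory.leftUnitor η.toStrongTrans)
  rightUnitor η := modIsoMk (Bicategory.rightUnitor η.toStrongTrans)
  whiskerLeft_id _ _ := Bicategory.whiskerLeft_id _ _
  whiskerLeft_comp _ _ _ _ _ _ := Bicategory.whiskerLeft_comp _ _ _
  id_whiskerLeft _ := Bicategory.id_whiskerLeft _
  comp_whiskerLeft _ _ _ _ _ := Bicategory.comp_whiskerLeft _ _ _
  id_whiskerRight _ _ := Bicategory.id_whiskerRight _ _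
  comp_whiskerRight _ _ _ := Bicategory.comp_whiskerRight _ _ _
  whiskerRight_id _ := Bicategory.whiskerRight_id _
  whiskerRight_comp _ _ _ := Bicategory.whiskerRight_comp _ _ _
  whisker_assoc _ _ _ _ _ := Bicategory.whisker_assoc _ _ _
  whisker_exchange {_ _ _ η η' θ θ'} Γ Δ := Bicategory.whisker_exchange (f := η.toStrongTrans)
    (g := η'.toStrongTrans) (h := θ.toStrongTrans) (i := θ'.toStrongTrans) Γ Δ
  pentagon η θ ι κ := Bicategory.pentagon η.toStrongTrans θ.toStrongTrans ι.toStrongTrans κ.toStrongTrans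
  triangle η θ := Bicategory.triangle η.toStrongTrans θ.toStrongTrans

end SMCat

/-!
### Biequivalences
-/

section Biequivalence

open CategoryTheory.Bicategory

/-- A biequivalence of `SMC`-categories: `SMC`-functors `functor : B → C` and `inverse : C → B` with an
equivalence `functor ∘ inverse ≃ 1` in the bicategory of `SMC`-functors `C → C` and an equivalence
`1 ≃ inverse ∘ functor` in the bicategory of `SMC`-functors `B → B`. -/
structure Biequivalence (B : Type u) [Bicategory.{w, v} B] [SMCategory B]
    (C : Type u') [Bicategory.{w', v'} C] [SMCategory C] where
  functor : SMCFunctor B C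
  inverse : SMCFunctor C B
  counit : SMCFunctor.comp inverse functor ≌ SMCFunctor.id C
  unit : SMCFunctor.id B ≌ SMCFunctor.comp functor inverse

end Biequivalence

/-!
### Locally full sub-`SMC`-categories
-/

section Sub

open MonoidalCategory Functor.LaxMonoidal
open CategoryTheory.Bicategory (precomposing postcomposing associatorNatIsoLeft
  associatorNatIsoMiddle associatorNatIsoRight leftUnitorNatIso rightUnitorNatIso)

/-- A class of 0-cells and a class of 1-cells of an `SMC`-category, such that the 1-cells of the class
between 0-cells of the class are closed under composition and sums and contain the identities and the
zero 1-cells. -/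
structure SubSMC (B : Type u) [Bicategory.{w, v} B] [SMCategory B] where
  obj : B → Prop
  hom : ∀ {a b : B}, (a ⟶ b) → Prop
  id_mem : ∀ {a : B}, obj a → hom (𝟙 a)
  comp_mem : ∀ {a b c : B}, obj a → obj b → obj c → ∀ (f : a ⟶ b) (g : b ⟶ c),
    hom f → hom g → hom (f ≫ g)
  zero_mem : ∀ {a b : B}, obj a → obj b → hom (𝟙_ (a ⟶ b))
  add_mem : ∀ {a b : B}, obj a → obj b → ∀ (f g : a ⟶ b), hom f → hom g → hom (f ⊗ g)

namespace SubSMC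

variable {B : Type u} [Bicategory.{w, v} B] [SMCategory B] (S : SubSMC B)

/-- The 0-cells of the sub-`SMC`-category. -/
structure Obj where
  val : B
  property : S.obj val

variable {S}

/-- The 1-cells of the sub-`SMC`-category. -/
structure Hom (X Y : S.Obj) where
  val : X.val ⟶ Y.val
  property : S.hom val

/-- The 2-cells of the sub-`SMC`-category are all 2-cells of `B`. -/
instance homCategory (X Y : S.Obj) : Category (Hom X Y) where
  Hom F G := F.val ⟶ G.val
  id F := 𝟙 F.val
  comp α β := α ≫ β
  id_comp α := Category.id_comp (obj := X.val ⟶ Y.val) α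
  comp_id α := Category.comp_id (obj := X.val ⟶ Y.val) α
  assoc α β γ := Category.assoc (obj := X.val ⟶ Y.val) α β γ

/-- The inclusion of hom-categories. -/
@[simps]
def homι (X Y : S.Obj) : Hom X Y ⥤ (X.val ⟶ Y.val) where
  obj F := F.val
  map α := α

/-- An invertible 2-cell of `B` as one of the sub-`SMC`-category. -/
def isoMk {X Y : S.Obj} {F G : Hom X Y} (e : F.val ≅ G.val) : F ≅ G where
  hom := e.hom
  inv := e.inv
  hom_inv_id := e.hom_inv_id
  inv_hom_id := e.inv_hom_id

/-- The locally full sub-bicategory: compositions and constraints are those of `B`. -/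
instance : Bicategory S.Obj where
  Hom X Y := Hom X Y
  id X := ⟨𝟙 X.val, S.id_mem X.property⟩
  comp {X Y Z} F G := ⟨F.val ≫ G.val,
    S.comp_mem X.property Y.property Z.property _ _ F.property G.property⟩
  homCategory X Y := homCategory X Y
  whiskerLeft F _ _ α := Bicategory.whiskerLeft F.val α
  whiskerRight α G := Bicategory.whiskerRight α G.val
  associator F G H := isoMk (Bicategory.associator F.val G.val H.val)
  leftUnitor F := isoMk (Bicategory.leftUnitor F.val)
  rightUnitor F := isoMk (Bicategory.rightUnitor F.val)
  whiskerLeft_id F G := Bicategory.whiskerLeft_id F.val G.val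
  whiskerLeft_comp F _ _ _ α β := Bicategory.whiskerLeft_comp F.val α β
  id_whiskerLeft α := Bicategory.id_whiskerLeft (B := B) α
  comp_whiskerLeft F G _ _ α := Bicategory.comp_whiskerLeft F.val G.val α
  id_whiskerRight F G := Bicategory.id_whiskerRight F.val G.val
  comp_whiskerRight α β G := Bicategory.comp_whiskerRight (B := B) α β G.val
  whiskerRight_id α := Bicategory.whiskerRight_id (B := B) α
  whiskerRight_comp α G H := Bicategory.whiskerRight_comp (B := B) α G.val H.val
  whisker_assoc F _ _ α H := Bicategory.whisker_assoc (B := B) F.val α H.val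
  whisker_exchange α β := Bicategory.whisker_exchange (B := B) α β
  pentagon F G H K := Bicategory.pentagon F.val G.val H.val K.val
  triangle F G := Bicategory.triangle F.val G.val

/-- Sums of 1-cells and 2-cells are those of `B`. -/
instance homMonoidal (X Y : S.Obj) : MonoidalCategory (X ⟶ Y) where
  tensorObj F G := ⟨F.val ⊗ G.val, S.add_mem X.property Y.property _ _ F.property G.property⟩
  whiskerLeft F _ _ α := MonoidalCategoryStruct.whiskerLeft (C := X.val ⟶ Y.val) F.val α
  whiskerRight α G := MonoidalCategoryStruct.whiskerRight (C := X.val ⟶ Y.val) α G.val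
  tensorHom α β := MonoidalCategoryStruct.tensorHom (C := X.val ⟶ Y.val) α β
  tensorUnit := ⟨𝟙_ (X.val ⟶ Y.val), S.zero_mem X.property Y.property⟩
  associator F G H := isoMk (α_ F.val G.val H.val)
  leftUnitor F := isoMk (λ_ F.val)
  rightUnitor F := isoMk (ρ_ F.val)
  tensorHom_def α β := MonoidalCategory.tensorHom_def (C := X.val ⟶ Y.val) α β
  id_tensorHom_id F G := MonoidalCategory.id_tensorHom_id F.val G.val
  tensorHom_comp_tensorHom f₁ f₂ g₁ g₂ :=
    MonoidalCategory.tensorHom_comp_tensorHom (C := X.val ⟶ Y.val) f₁ f₂ g₁ g₂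
  whiskerLeft_id F G := MonoidalCategory.whiskerLeft_id F.val G.val
  id_whiskerRight F G := MonoidalCategory.id_whiskerRight F.val G.val
  associator_naturality f g h :=
    MonoidalCategory.associator_naturality (C := X.val ⟶ Y.val) f g h
  leftUnitor_naturality f := MonoidalCategory.leftUnitor_naturality (C := X.val ⟶ Y.val) f
  rightUnitor_naturality f := MonoidalCategory.rightUnitor_naturality (C := X.val ⟶ Y.val) f
  pentagon F G H K := MonoidalCategory.pentagon F.val G.val H.val K.val
  triangle F G := MonoidalCategory.triangle F.val G.val

/-- The symmetry is that of `B`. -/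
instance homSymmetric (X Y : S.Obj) : SymmetricCategory (X ⟶ Y) where
  braiding F G := isoMk (β_ F.val G.val)
  braiding_naturality_right F _ _ α :=
    BraidedCategory.braiding_naturality_right (C := X.val ⟶ Y.val) F.val α
  braiding_naturality_left α F :=
    BraidedCategory.braiding_naturality_left (C := X.val ⟶ Y.val) α F.val
  hexagon_forward F G H := BraidedCategory.hexagon_forward F.val G.val H.val
  hexagon_reverse F G H := BraidedCategory.hexagon_reverse F.val G.val H.val
  symmetry F G := SymmetricCategory.symmetry F.val G.val

/-- The distributivity isomorphisms are those of `B`. -/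
def precomposingMonoidal (X Y Z : S.Obj) : (precomposing X Y Z).CoreMonoidal where
  εIso := NatIso.ofComponents
    (fun G => isoMk ((Functor.Monoidal.εIso (precomposing X.val Y.val Z.val)).app G.val))
    (fun {_ _} α => (ε (precomposing X.val Y.val Z.val)).naturality α)
  μIso F F' := NatIso.ofComponents
    (fun G => isoMk ((Functor.Monoidal.μIso (precomposing X.val Y.val Z.val) F.val F'.val).app
      G.val))
    (fun {_ _} α => (μ (precomposing X.val Y.val Z.val) F.val F'.val).naturality α)
  μIso_hom_natural_left α F := NatTrans.ext (funext fun G =>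
    NatTrans.congr_app (μ_natural_left (precomposing X.val Y.val Z.val) α F.val) G.val)
  μIso_hom_natural_right F α := NatTrans.ext (funext fun G =>
    NatTrans.congr_app (μ_natural_right (precomposing X.val Y.val Z.val) F.val α) G.val)
  associativity F F' F'' := NatTrans.ext (funext fun G =>
    NatTrans.congr_app (associativity (precomposing X.val Y.val Z.val) F.val F'.val F''.val)
      G.val)
  left_unitality F := NatTrans.ext (funext fun G =>
    NatTrans.congr_app (left_unitality (precomposing X.val Y.val Z.val) F.val) G.val)
  right_unitality F := NatTrans.ext (funext fun G =>
    NatTrans.congr_app (right_unitality (precomposing X.val Y.val Z.val) F.val) G.val)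

/-- The distributivity isomorphisms are those of `B`. -/
def postcomposingMonoidal (X Y Z : S.Obj) : (postcomposing X Y Z).CoreMonoidal where
  εIso := NatIso.ofComponents
    (fun G => isoMk ((Functor.Monoidal.εIso (postcomposing X.val Y.val Z.val)).app G.val))
    (fun {_ _} α => (ε (postcomposing X.val Y.val Z.val)).naturality α)
  μIso F F' := NatIso.ofComponents
    (fun G => isoMk ((Functor.Monoidal.μIso (postcomposing X.val Y.val Z.val) F.val F'.val).app
      G.val))
    (fun {_ _} α => (μ (postcomposing X.val Y.val Z.val) F.val F'.val).naturality α)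
  μIso_hom_natural_left α F := NatTrans.ext (funext fun G =>
    NatTrans.congr_app (μ_natural_left (postcomposing X.val Y.val Z.val) α F.val) G.val)
  μIso_hom_natural_right F α := NatTrans.ext (funext fun G =>
    NatTrans.congr_app (μ_natural_right (postcomposing X.val Y.val Z.val) F.val α) G.val)
  associativity F F' F'' := NatTrans.ext (funext fun G =>
    NatTrans.congr_app (associativity (postcomposing X.val Y.val Z.val) F.val F'.val F''.val)
      G.val)
  left_unitality F := NatTrans.ext (funext fun G =>
    NatTrans.congr_app (left_unitality (postcomposing X.val Y.val Z.val) F.val) G.val)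
  right_unitality F := NatTrans.ext (funext fun G =>
    NatTrans.congr_app (right_unitality (postcomposing X.val Y.val Z.val) F.val) G.val)

instance : BilinearComposition S.Obj where
  homMonoidal := homMonoidal
  homSymmetric := homSymmetric
  precomposingBraided X Y Z :=
    { toMonoidal := (precomposingMonoidal X Y Z).toMonoidal
      braided F F' := NatTrans.ext (funext fun G => NatTrans.congr_app
        (Functor.LaxBraided.braided (F := precomposing X.val Y.val Z.val) F.val F'.val) G.val) }
  postcomposingBraided X Y Z :=
    { toMonoidal := (postcomposingMonoidal X Y Z).toMonoidal
      braided F F' := NatTrans.ext (funext fun G => NatTrans.congr_app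
        (Functor.LaxBraided.braided (F := postcomposing X.val Y.val Z.val) F.val F'.val) G.val) }

/-- The locally full sub-`SMC`-category of `B`. -/
instance : SMCategory S.Obj where
  isMonoidal_precomposing_μ {X Y} Z F F' :=
    have h := SMCategory.isMonoidal_precomposing_μ Z.val F.val F'.val
    { unit := h.unit, tensor := fun G G' => h.tensor G.val G'.val }
  isMonoidal_postcomposing_μ X {Y Z} G G' :=
    have h := SMCategory.isMonoidal_postcomposing_μ X.val G.val G'.val
    { unit := h.unit, tensor := fun F F' => h.tensor F.val F'.val }
  isMonoidal_precomposing_ε X Y Z :=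
    have h := SMCategory.isMonoidal_precomposing_ε X.val Y.val Z.val
    { unit := h.unit, tensor := fun G G' => h.tensor G.val G'.val }
  isMonoidal_postcomposing_ε X Y Z :=
    have h := SMCategory.isMonoidal_postcomposing_ε X.val Y.val Z.val
    { unit := h.unit, tensor := fun F F' => h.tensor F.val F'.val }
  isMonoidal_associator_left X {Y Z W} G H :=
    have h := SMCategory.isMonoidal_associator_left X.val G.val H.val
    { unit := h.unit, tensor := fun F F' => h.tensor F.val F'.val }
  isMonoidal_associator_middle {X Y Z W} F H :=
    have h := SMCategory.isMonoidal_associator_middle F.val H.val (b := Y.val) (c := Z.val)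
    { unit := h.unit, tensor := fun F F' => h.tensor F.val F'.val }
  isMonoidal_associator_right {X Y Z} F G W :=
    have h := SMCategory.isMonoidal_associator_right F.val G.val W.val
    { unit := h.unit, tensor := fun F F' => h.tensor F.val F'.val }
  isMonoidal_leftUnitor X Y :=
    have h := SMCategory.isMonoidal_leftUnitor X.val Y.val
    { unit := h.unit, tensor := fun F F' => h.tensor F.val F'.val }
  isMonoidal_rightUnitor X Y :=
    have h := SMCategory.isMonoidal_rightUnitor X.val Y.val
    { unit := h.unit, tensor := fun F F' => h.tensor F.val F'.val }

variable (S)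

/-- The inclusion pseudofunctor, with identity constraints. -/
def inclusionPseudofunctor : Pseudofunctor S.Obj B where
  obj X := X.val
  map F := F.val
  map₂ α := α
  mapId X := Iso.refl (𝟙 X.val)
  mapComp F G := Iso.refl (F.val ≫ G.val)
  map₂_id _ := rfl
  map₂_comp _ _ := rfl
  map₂_whisker_left F _ _ α := by
    change Bicategory.whiskerLeft F.val α = 𝟙 _ ≫ Bicategory.whiskerLeft F.val α ≫ 𝟙 _
    rw [Category.id_comp, Category.comp_id]
  map₂_whisker_right {X Y Z F F'} α G := by
    change Bicategory.whiskerRight (B := B) α G.val =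
      𝟙 (F.val ≫ G.val) ≫ Bicategory.whiskerRight (B := B) α G.val ≫ 𝟙 (F'.val ≫ G.val)
    rw [Category.id_comp, Category.comp_id]
  map₂_associator F G H := by
    change (Bicategory.associator F.val G.val H.val).hom =
      𝟙 _ ≫ Bicategory.whiskerRight (𝟙 (F.val ≫ G.val)) H.val ≫
        (Bicategory.associator F.val G.val H.val).hom ≫
        Bicategory.whiskerLeft F.val (𝟙 (G.val ≫ H.val)) ≫ 𝟙 _
    simp
  map₂_left_unitor {X Y} F := by
    change (Bicategory.leftUnitor F.val).hom =
      𝟙 _ ≫ Bicategory.whiskerRight (𝟙 (𝟙 X.val)) F.val ≫ (Bicategory.leftUnitor F.val).hom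
    simp
  map₂_right_unitor {X Y} F := by
    change (Bicategory.rightUnitor F.val).hom =
      𝟙 _ ≫ Bicategory.whiskerLeft F.val (𝟙 (𝟙 Y.val)) ≫ (Bicategory.rightUnitor F.val).hom
    simp

/-- The inclusion preserves sums, units and symmetries strictly. -/
instance inclusionBraided (X Y : S.Obj) :
    ((inclusionPseudofunctor S).mapFunctor X Y).Braided where
  toMonoidal := Functor.CoreMonoidal.toMonoidal
    { εIso := Iso.refl (𝟙_ (X.val ⟶ Y.val))
      μIso := fun F G => Iso.refl (F.val ⊗ G.val)
      μIso_hom_natural_left := fun {F F'} α G => by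
        change (MonoidalCategoryStruct.whiskerRight (C := X.val ⟶ Y.val) α G.val) ≫ 𝟙 _ =
          𝟙 _ ≫ MonoidalCategoryStruct.whiskerRight (C := X.val ⟶ Y.val) α G.val
        simp
      μIso_hom_natural_right := fun {F F'} G α => by
        change (MonoidalCategoryStruct.whiskerLeft (C := X.val ⟶ Y.val) G.val α) ≫ 𝟙 _ =
          𝟙 _ ≫ MonoidalCategoryStruct.whiskerLeft (C := X.val ⟶ Y.val) G.val α
        simp
      associativity := fun F G H => by
        change (𝟙 (F.val ⊗ G.val) ▷ H.val) ≫ 𝟙 _ ≫ (α_ F.val G.val H.val).hom =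
          (α_ F.val G.val H.val).hom ≫ F.val ◁ 𝟙 (G.val ⊗ H.val) ≫ 𝟙 _
        simp
      left_unitality := fun F => by
        change (λ_ F.val).hom = 𝟙 (𝟙_ _) ▷ F.val ≫ 𝟙 _ ≫ (λ_ F.val).hom
        simp
      right_unitality := fun F => by
        change (ρ_ F.val).hom = F.val ◁ 𝟙 (𝟙_ _) ≫ 𝟙 _ ≫ (ρ_ F.val).hom
        simp }
  braided F G := by
    change 𝟙 _ ≫ (β_ F.val G.val).hom = (β_ F.val G.val).hom ≫ 𝟙 _
    simp

/-- The inclusion `SMC`-functor; all its constraints are identities. -/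
def inclusion : SMCFunctor S.Obj B where
  toPseudofunctor := inclusionPseudofunctor S
  braided := inclusionBraided S
  isMonoidal_precomp {X Y} F Z :=
    { unit := by
        change (𝟙 _ ≫ ε ((precomposing X.val Y.val Z.val).obj F.val)) ≫ 𝟙 _ =
          ε ((precomposing X.val Y.val Z.val).obj F.val) ≫
            ((precomposing X.val Y.val Z.val).obj F.val).map (𝟙 _)
        simp
      tensor := fun G G' => by
        change (𝟙 _ ≫ μ ((precomposing X.val Y.val Z.val).obj F.val) G.val G'.val) ≫ 𝟙 _ =
          (𝟙 (F.val ≫ G.val) ⊗ₘ 𝟙 (F.val ≫ G'.val)) ≫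
            μ ((precomposing X.val Y.val Z.val).obj F.val) G.val G'.val ≫
            ((precomposing X.val Y.val Z.val).obj F.val).map (𝟙 _)
        simp
        exact (Category.comp_id _).symm }
  isMonoidal_postcomp X {Y Z} G :=
    { unit := by
        change (𝟙 _ ≫ ε ((postcomposing X.val Y.val Z.val).obj G.val)) ≫ 𝟙 _ =
          ε ((postcomposing X.val Y.val Z.val).obj G.val) ≫
            ((postcomposing X.val Y.val Z.val).obj G.val).map (𝟙 _)
        simp
      tensor := fun F F' => by
        change (𝟙 _ ≫ μ ((postcomposing X.val Y.val Z.val).obj G.val) F.val F'.val) ≫ 𝟙 _ =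
          (𝟙 (F.val ≫ G.val) ⊗ₘ 𝟙 (F'.val ≫ G.val)) ≫
            μ ((postcomposing X.val Y.val Z.val).obj G.val) F.val F'.val ≫
            ((postcomposing X.val Y.val Z.val).obj G.val).map (𝟙 _)
        simp
        exact (Category.comp_id _).symm }

end SubSMC
end Sub

/-!
### Symmetric monoidal categories
-/

section SymMon

open MonoidalCategory Functor Functor.LaxMonoidal

/-- A symmetric monoidal category. -/
structure SymMon : Type (max (u + 1) (v + 1)) where
  carrier : Type u
  [category : Category.{v} carrier]
  [monoidal : MonoidalCategory carrier]
  [symmetric : SymmetricCategory carrier]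

attribute [instance] SymMon.category SymMon.monoidal SymMon.symmetric

namespace SymMon

/-- A symmetric strong monoidal functor. -/
structure Hom (P Q : SymMon.{v, u}) : Type (max u v) where
  functor : P.carrier ⥤ Q.carrier
  [braided : functor.Braided]

attribute [instance] Hom.braided

/-- A monoidal transformation. -/
@[ext]
structure Hom₂ {P Q : SymMon.{v, u}} (F G : Hom P Q) : Type (max u v) where
  natTrans : F.functor ⟶ G.functor
  [isMonoidal : NatTrans.IsMonoidal natTrans]

attribute [instance] Hom₂.isMonoidal

variable {P Q R S : SymMon.{v, u}}

/-- Symmetric strong monoidal functors and monoidal transformations. -/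
instance homCategory (P Q : SymMon.{v, u}) : Category (Hom P Q) where
  Hom F G := Hom₂ F G
  id F := ⟨𝟙 F.functor⟩
  comp α β := ⟨α.natTrans ≫ β.natTrans⟩

@[simp] theorem id_natTrans (F : Hom P Q) : Hom₂.natTrans (𝟙 F) = 𝟙 F.functor := rfl
@[simp] theorem comp_natTrans {F G H : Hom P Q} (α : F ⟶ G) (β : G ⟶ H) :
    (α ≫ β).natTrans = α.natTrans ≫ β.natTrans := rfl
@[ext] theorem hom₂_ext {F G : Hom P Q} {α β : F ⟶ G}
    (h : ∀ x, α.natTrans.app x = β.natTrans.app x) : α = β :=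
  Hom₂.ext (NatTrans.ext (funext h))

/-- A monoidal natural isomorphism. -/
def isoMk {F G : Hom P Q} (e : F.functor ≅ G.functor) (h : NatTrans.IsMonoidal e.hom) :
    F ≅ G where
  hom := ⟨e.hom⟩
  inv := ⟨e.inv⟩

/-- The underlying functor and natural transformation. -/
def forget (P Q : SymMon.{v, u}) : Hom P Q ⥤ (P.carrier ⥤ Q.carrier) where
  obj F := F.functor
  map α := α.natTrans

instance : (forget P Q).Faithful where
  map_injective h := Hom₂.ext h

theorem isMonoidal_tensorHom {F F' G G' : Hom P Q} (α : F ⟶ F') (β : G ⟶ G') :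
    NatTrans.IsMonoidal (F₁ := F.functor ⊗ G.functor) (F₂ := F'.functor ⊗ G'.functor)
      (α.natTrans ⊗ₘ β.natTrans) where
  unit := by
    change ((λ_ _).inv ≫ (ε F.functor ⊗ₘ ε G.functor)) ≫
      (α.natTrans.app _ ⊗ₘ β.natTrans.app _) = (λ_ _).inv ≫ (ε F'.functor ⊗ₘ ε G'.functor)
    rw [Category.assoc, tensorHom_comp_tensorHom, NatTrans.IsMonoidal.unit,
      NatTrans.IsMonoidal.unit]
  tensor X Y := by
    change (tensorμ _ _ _ _ ≫ (μ F.functor X Y ⊗ₘ μ G.functor X Y)) ≫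
      (α.natTrans.app _ ⊗ₘ β.natTrans.app _) =
      ((α.natTrans.app X ⊗ₘ β.natTrans.app X) ⊗ₘ (α.natTrans.app Y ⊗ₘ β.natTrans.app Y)) ≫
       tensorμ _ _ _ _ ≫ (μ F'.functor X Y ⊗ₘ μ G'.functor X Y)
    rw [Category.assoc, tensorHom_comp_tensorHom, NatTrans.IsMonoidal.tensor,
      NatTrans.IsMonoidal.tensor, tensorμ_natural_assoc, tensorHom_comp_tensorHom]

theorem isMonoidal_associator (F G H : Hom P Q) :
    NatTrans.IsMonoidal (F₁ := (F.functor ⊗ G.functor) ⊗ H.functor)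
      (F₂ := F.functor ⊗ (G.functor ⊗ H.functor))
      (α_ F.functor G.functor H.functor).hom where
  unit := by
    change ((λ_ _).inv ≫ (((λ_ _).inv ≫ (ε F.functor ⊗ₘ ε G.functor)) ⊗ₘ ε H.functor)) ≫
      (α_ _ _ _).hom = (λ_ _).inv ≫ (ε F.functor ⊗ₘ ((λ_ _).inv ≫ (ε G.functor ⊗ₘ ε H.functor)))
    monoidal
  tensor X Y := by
    have h := associator_monoidal (F.functor.obj X) (G.functor.obj X) (H.functor.obj X)
      (F.functor.obj Y) (G.functor.obj Y) (H.functor.obj Y)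
    change (tensorμ _ _ _ _ ≫ ((tensorμ _ _ _ _ ≫ (μ F.functor X Y ⊗ₘ μ G.functor X Y)) ⊗ₘ
       μ H.functor X Y)) ≫ (α_ _ _ _).hom =
      ((α_ _ _ _).hom ⊗ₘ (α_ _ _ _).hom) ≫ tensorμ _ _ _ _ ≫ (μ F.functor X Y ⊗ₘ
      (tensorμ _ _ _ _ ≫ (μ G.functor X Y ⊗ₘ μ H.functor X Y)))
    rw [Category.assoc, ← Category.id_comp (μ H.functor X Y), ← tensorHom_comp_tensorHom,
      ← Category.id_comp (μ F.functor X Y), ← tensorHom_comp_tensorHom, Category.assoc,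
      MonoidalCategory.associator_naturality, tensorHom_id, id_tensorHom,
      reassoc_of% h]
    simp only [Category.id_comp]

theorem isMonoidal_leftUnitor (F : Hom P Q) :
    NatTrans.IsMonoidal (F₁ := 𝟙_ (P.carrier ⥤ Q.carrier) ⊗ F.functor)
      (F₂ := F.functor) (λ_ F.functor).hom where
  unit := by
    change ((λ_ _).inv ≫ (𝟙 (𝟙_ Q.carrier) ⊗ₘ ε F.functor)) ≫ (λ_ _).hom = ε F.functor
    simp
  tensor X Y := by
    have h := leftUnitor_monoidal (F.functor.obj X) (F.functor.obj Y)
    change (tensorμ _ _ _ _ ≫ ((λ_ (𝟙_ Q.carrier)).hom ⊗ₘ μ F.functor X Y)) ≫ (λ_ _).hom =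
      ((λ_ _).hom ⊗ₘ (λ_ _).hom) ≫ μ F.functor X Y
    rw [Category.assoc, MonoidalCategory.tensorHom_def, Category.assoc, leftUnitor_naturality,
      reassoc_of% h]

theorem isMonoidal_rightUnitor (F : Hom P Q) :
    NatTrans.IsMonoidal (F₁ := F.functor ⊗ 𝟙_ (P.carrier ⥤ Q.carrier))
      (F₂ := F.functor) (ρ_ F.functor).hom where
  unit := by
    change ((λ_ _).inv ≫ (ε F.functor ⊗ₘ 𝟙 (𝟙_ Q.carrier))) ≫ (ρ_ _).hom = ε F.functor
    simp [unitors_inv_equal]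
  tensor X Y := by
    have h := rightUnitor_monoidal (F.functor.obj X) (F.functor.obj Y)
    change (tensorμ _ _ _ _ ≫ (μ F.functor X Y ⊗ₘ (λ_ (𝟙_ Q.carrier)).hom)) ≫ (ρ_ _).hom =
      ((ρ_ _).hom ⊗ₘ (ρ_ _).hom) ≫ μ F.functor X Y
    rw [Category.assoc, MonoidalCategory.tensorHom_def', Category.assoc, rightUnitor_naturality,
      reassoc_of% h]

theorem isMonoidal_braiding (F G : Hom P Q) :
    NatTrans.IsMonoidal (F₁ := F.functor ⊗ G.functor)
      (F₂ := G.functor ⊗ F.functor) (β_ F.functor G.functor).hom where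
  unit := by
    change ((λ_ _).inv ≫ (ε F.functor ⊗ₘ ε G.functor)) ≫ (β_ _ _).hom =
      (λ_ _).inv ≫ (ε G.functor ⊗ₘ ε F.functor)
    rw [Category.assoc, BraidedCategory.braiding_naturality, braiding_tensorUnit_left]
    simp [← unitors_inv_equal]
  tensor X Y := by
    change (tensorμ _ _ _ _ ≫ (μ F.functor X Y ⊗ₘ μ G.functor X Y)) ≫ (β_ _ _).hom =
      ((β_ _ _).hom ⊗ₘ (β_ _ _).hom) ≫ tensorμ _ _ _ _ ≫ (μ G.functor X Y ⊗ₘ μ F.functor X Y)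
    rw [Category.assoc, BraidedCategory.braiding_naturality, reassoc_of% tensorμ_braiding']

/-- The pointwise sum of symmetric strong monoidal functors (with the structure of `sumBraided`), with
unit the constant functor at the unit (with the structure of `zeroBraided`). -/
instance : MonoidalCategoryStruct (Hom P Q) where
  tensorObj F G := ⟨F.functor ⊗ G.functor⟩
  whiskerLeft F G G' β :=
    { natTrans := F.functor ◁ β.natTrans
      isMonoidal := by
        rw [← id_tensorHom]; exact isMonoidal_tensorHom (𝟙 F) β }
  whiskerRight {F F'} α G :=
    { natTrans := α.natTrans ▷ G.functor
      isMonoidal := by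
        rw [← tensorHom_id]; exact isMonoidal_tensorHom α (𝟙 G) }
  tensorHom α β := { natTrans := α.natTrans ⊗ₘ β.natTrans
                     isMonoidal := isMonoidal_tensorHom α β }
  tensorUnit := ⟨𝟙_ (P.carrier ⥤ Q.carrier)⟩
  associator F G H := isoMk (α_ F.functor G.functor H.functor) (isMonoidal_associator F G H)
  leftUnitor F := isoMk (λ_ F.functor) (isMonoidal_leftUnitor F)
  rightUnitor F := isoMk (ρ_ F.functor) (isMonoidal_rightUnitor F)

/-- The forgetful functor to `P.carrier ⥤ Q.carrier` preserves the pointwise structure strictly. -/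
def forgetData (P Q : SymMon.{v, u}) : Monoidal.InducingFunctorData (forget P Q) where
  μIso F G := Iso.refl (F.functor ⊗ G.functor)
  εIso := Iso.refl (𝟙_ (P.carrier ⥤ Q.carrier))
  whiskerLeft_eq F G G' β := by
    ext x
    change F.functor.obj x ◁ β.natTrans.app x = 𝟙 _ ≫ (F.functor.obj x ◁ β.natTrans.app x) ≫ 𝟙 _
    simp
  whiskerRight_eq {F F'} α G := by
    ext x
    change α.natTrans.app x ▷ G.functor.obj x = 𝟙 _ ≫ (α.natTrans.app x ▷ G.functor.obj x) ≫ 𝟙 _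
    simp
  tensorHom_eq {F F' G G'} α β := by
    ext x
    change (α.natTrans.app x ⊗ₘ β.natTrans.app x) =
      𝟙 _ ≫ (α.natTrans.app x ⊗ₘ β.natTrans.app x) ≫ 𝟙 _
    simp
  associator_eq F G H := by
    ext x
    change (α_ (F.functor.obj x) (G.functor.obj x) (H.functor.obj x)).hom =
      (𝟙 _ ≫ (𝟙 _ ⊗ₘ 𝟙 _)) ≫ (α_ (F.functor.obj x) (G.functor.obj x) (H.functor.obj x)).hom ≫
        (𝟙 _ ⊗ₘ 𝟙 _) ≫ 𝟙 _
    simp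
  leftUnitor_eq F := by
    ext x
    change (λ_ (F.functor.obj x)).hom =
      (𝟙 _ ≫ (𝟙 _ ⊗ₘ 𝟙 _)) ≫ (λ_ (F.functor.obj x)).hom
    simp
  rightUnitor_eq F := by
    ext x
    change (ρ_ (F.functor.obj x)).hom =
      (𝟙 _ ≫ (𝟙 _ ⊗ₘ 𝟙 _)) ≫ (ρ_ (F.functor.obj x)).hom
    simp

/-- The pointwise monoidal structure. -/
instance : MonoidalCategory (Hom P Q) := Monoidal.induced (forget P Q) (forgetData P Q)

instance : (forget P Q).Monoidal :=
  (Monoidal.fromInducedCoreMonoidal (forget P Q) (forgetData P Q)).toMonoidal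

/-- The pointwise braiding. -/
instance : BraidedCategory (Hom P Q) :=
  .ofFaithful (forget P Q) (fun F G => isoMk (β_ F.functor G.functor) (isMonoidal_braiding F G))
   (fun F G => by
      change 𝟙 _ ≫ (β_ F.functor G.functor).hom = (β_ F.functor G.functor).hom ≫ 𝟙 _
      simp)

instance : SymmetricCategory (Hom P Q) where
  symmetry F G := by
    ext x
    exact SymmetricCategory.symmetry (F.functor.obj x) (G.functor.obj x)

/-- The (strict) bicategory of symmetric monoidal categories, symmetric strong monoidal functors and
monoidal transformations. -/
instance : Bicategory SymMon.{v, u} where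
  Hom P Q := Hom P Q
  id P := ⟨𝟭 P.carrier⟩
  comp F G := ⟨F.functor ⋙ G.functor⟩
  homCategory P Q := homCategory P Q
  whiskerLeft F _ _ α := ⟨Functor.whiskerLeft F.functor α.natTrans⟩
  whiskerRight α G := ⟨Functor.whiskerRight α.natTrans G.functor⟩
  associator F G H := isoMk (Functor.associator F.functor G.functor H.functor) inferInstance
  leftUnitor F := isoMk F.functor.leftUnitor inferInstance
  rightUnitor F := isoMk F.functor.rightUnitor inferInstance
  whiskerLeft_id _ _ := by
    ext x
    rfl
  whiskerLeft_comp _ _ _ _ _ _ := by ext x; rfl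
  id_whiskerLeft {P Q F G} α := by
    ext x
    change α.natTrans.app x = 𝟙 _ ≫ α.natTrans.app x ≫ 𝟙 _
    simp
  comp_whiskerLeft F G _ _ α := by
    ext x
    change α.natTrans.app _ = 𝟙 _ ≫ α.natTrans.app _ ≫ 𝟙 _
    simp
  id_whiskerRight F G := by
    ext x
    exact G.functor.map_id _
  comp_whiskerRight α β G := by
    ext x
    exact G.functor.map_comp _ _
  whiskerRight_id α := by
    ext x
    change α.natTrans.app x = 𝟙 _ ≫ α.natTrans.app x ≫ 𝟙 _
    simp
  whiskerRight_comp {P Q R S F F'} α G H := by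
    ext x
    change H.functor.map (G.functor.map (α.natTrans.app x)) =
      𝟙 _ ≫ H.functor.map (G.functor.map (α.natTrans.app x)) ≫ 𝟙 _
    simp
  whisker_assoc F G G' α H := by
    ext x
    change H.functor.map (α.natTrans.app (F.functor.obj x)) =
      𝟙 _ ≫ H.functor.map (α.natTrans.app (F.functor.obj x)) ≫ 𝟙 _
    simp
  whisker_exchange {P Q R F F' G G'} α β := by
    ext x
    exact (β.natTrans.naturality (α.natTrans.app x)).symm
  pentagon {P Q R S T} F G H K := by
    ext x
    change K.functor.map (𝟙 (H.functor.obj (G.functor.obj (F.functor.obj x)))) ≫ 𝟙 _ ≫ 𝟙 _ =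
      𝟙 _ ≫ 𝟙 _
    simp
  triangle {P Q R} F G := by
    ext x
    change 𝟙 _ ≫ 𝟙 _ = G.functor.map (𝟙 (F.functor.obj x))
    simp

instance homMonoidal (P Q : SymMon.{v, u}) : MonoidalCategory (P ⟶ Q) :=
  inferInstanceAs (MonoidalCategory (Hom P Q))

instance homSymmetric (P Q : SymMon.{v, u}) : SymmetricCategory (P ⟶ Q) :=
  inferInstanceAs (SymmetricCategory (Hom P Q))

open CategoryTheory.Bicategory (precomposing postcomposing)

theorem ε_ε_μ (F : P ⟶ Q) :
    (λ_ _).inv ≫ (ε F.functor ⊗ₘ ε F.functor) ≫ μ F.functor (𝟙_ _) (𝟙_ _) =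
      ε F.functor ≫ F.functor.map (λ_ _).inv := by
  rw [MonoidalCategory.tensorHom_def', Category.assoc, ← leftUnitor_inv_naturality_assoc,
    LaxMonoidal.left_unitality_inv]

/-- `F₁ ≫ G ⊗ F₂ ≫ G ≅ (F₁ ⊗ F₂) ≫ G`, with components the structure morphisms of `G`. -/
def distribRight (F₁ F₂ : P ⟶ Q) (G : Q ⟶ R) : (F₁ ≫ G) ⊗ (F₂ ≫ G) ≅ (F₁ ⊗ F₂) ≫ G :=
  isoMk (P := P) (Q := R) (NatIso.ofComponents
    (fun x => Monoidal.μIso G.functor (F₁.functor.obj x) (F₂.functor.obj x))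
    (fun f => μ_natural G.functor (F₁.functor.map f) (F₂.functor.map f)))
    { unit := by
        change ((λ_ _).inv ≫ ((ε G.functor ≫ G.functor.map (ε F₁.functor)) ⊗ₘ
           (ε G.functor ≫ G.functor.map (ε F₂.functor)))) ≫ μ G.functor _ _ =
          ε G.functor ≫ G.functor.map ((λ_ _).inv ≫ (ε F₁.functor ⊗ₘ ε F₂.functor))
        rw [← tensorHom_comp_tensorHom, Category.assoc, Category.assoc, μ_natural,
          reassoc_of% (ε_ε_μ G), Functor.map_comp]
      tensor := fun x y => by
        change (tensorμ _ _ _ _ ≫ ((μ G.functor _ _ ≫ G.functor.map (μ F₁.functor x y)) ⊗ₘ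
           (μ G.functor _ _ ≫ G.functor.map (μ F₂.functor x y)))) ≫ μ G.functor _ _ =
          (μ G.functor (F₁.functor.obj x) (F₂.functor.obj x) ⊗ₘ
            μ G.functor (F₁.functor.obj y) (F₂.functor.obj y)) ≫ μ G.functor _ _ ≫
            G.functor.map (tensorμ _ _ _ _ ≫ (μ F₁.functor x y ⊗ₘ μ F₂.functor x y))
        have h := tensorμ_comp_μ_tensorHom_μ_comp_μ G.functor
          (F₁.functor.obj x) (F₂.functor.obj x) (F₁.functor.obj y) (F₂.functor.obj y)
        rw [← tensorHom_comp_tensorHom, Category.assoc, Category.assoc, μ_natural,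
          reassoc_of% h, Functor.map_comp] }

/-- `𝟙_ ≅ 𝟙_ ≫ G`, with components the unit constraint of `G`. -/
def nullRight (P : SymMon.{v, u}) (G : Q ⟶ R) : 𝟙_ (P ⟶ R) ≅ 𝟙_ (P ⟶ Q) ≫ G :=
  isoMk (P := P) (Q := R) (NatIso.ofComponents (fun _ => Monoidal.εIso G.functor) (fun _ => by
      change 𝟙 _ ≫ ε G.functor = ε G.functor ≫ G.functor.map (𝟙 _)
      simp))
    { unit := by
        change 𝟙 _ ≫ ε G.functor = ε G.functor ≫ G.functor.map (𝟙 _)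
        simp
      tensor := fun x y => by
        change (λ_ _).hom ≫ ε G.functor =
          (ε G.functor ⊗ₘ ε G.functor) ≫ μ G.functor _ _ ≫ G.functor.map (λ_ _).hom
        rw [← cancel_epi (λ_ _).inv, reassoc_of% (ε_ε_μ G), ← Functor.map_comp]
        simp }

/-- `F ≫ G₁ ⊗ F ≫ G₂ ≅ F ≫ (G₁ ⊗ G₂)`, with identity components. -/
def distribLeft (F : P ⟶ Q) (G₁ G₂ : Q ⟶ R) : (F ≫ G₁) ⊗ (F ≫ G₂) ≅ F ≫ (G₁ ⊗ G₂) :=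
  isoMk (P := P) (Q := R) (Iso.refl (F.functor ⋙ (G₁.functor ⊗ G₂.functor)))
    { unit := by
        change ((λ_ _).inv ≫ ((ε G₁.functor ≫ G₁.functor.map (ε F.functor)) ⊗ₘ
           (ε G₂.functor ≫ G₂.functor.map (ε F.functor)))) ≫ 𝟙 _ =
          ((λ_ _).inv ≫ (ε G₁.functor ⊗ₘ ε G₂.functor)) ≫
            (G₁.functor.map (ε F.functor) ⊗ₘ G₂.functor.map (ε F.functor))
        simp
      tensor := fun x y => by
        change (tensorμ _ _ _ _ ≫ ((μ G₁.functor _ _ ≫ G₁.functor.map (μ F.functor x y)) ⊗ₘ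
           (μ G₂.functor _ _ ≫ G₂.functor.map (μ F.functor x y)))) ≫ 𝟙 _ =
          (𝟙 _ ⊗ₘ 𝟙 _) ≫ (tensorμ _ _ _ _ ≫ (μ G₁.functor _ _ ⊗ₘ μ G₂.functor _ _)) ≫
            (G₁.functor.map (μ F.functor x y) ⊗ₘ G₂.functor.map (μ F.functor x y))
        simp }

/-- `𝟙_ ≅ F ≫ 𝟙_`, with identity components. -/
def nullLeft (F : P ⟶ Q) (R : SymMon.{v, u}) : 𝟙_ (P ⟶ R) ≅ F ≫ 𝟙_ (Q ⟶ R) :=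
  isoMk (P := P) (Q := R) (Iso.refl (𝟙_ (P.carrier ⥤ R.carrier)))
    { unit := by
        change 𝟙 _ ≫ 𝟙 _ = 𝟙 (𝟙_ R.carrier) ≫ 𝟙 _
        simp
      tensor := fun x y => by
        change (λ_ (𝟙_ R.carrier)).hom ≫ 𝟙 _ = (𝟙 _ ⊗ₘ 𝟙 _) ≫ (λ_ _).hom ≫ 𝟙 _
        simp }

/-- `F ↦ (F ≫ -)` is strong monoidal. -/
def precomposingMonoidal (P Q R : SymMon.{v, u}) : (precomposing P Q R).CoreMonoidal where
  εIso := NatIso.ofComponents (fun G => nullRight P G) (fun {G G'} α => by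
    refine hom₂_ext (P := P) (Q := R) fun x => ?_
    change 𝟙 _ ≫ ε G'.functor = ε G.functor ≫ α.natTrans.app _
    rw [NatTrans.IsMonoidal.unit, Category.id_comp])
  μIso F₁ F₂ := NatIso.ofComponents (fun G => distribRight F₁ F₂ G) (fun {G G'} α => by
    refine hom₂_ext (P := P) (Q := R) fun x => ?_
    exact (NatTrans.IsMonoidal.tensor (τ := α.natTrans) _ _).symm)
  μIso_hom_natural_left {F F'} α F₂ := by
    refine NatTrans.ext (funext fun G => hom₂_ext (P := P) (Q := R) fun x => ?_)
    exact μ_natural_left G.functor (α.natTrans.app x) (F₂.functor.obj x)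
  μIso_hom_natural_right F₂ α := by
    refine NatTrans.ext (funext fun G => hom₂_ext (P := P) (Q := R) fun x => ?_)
    exact μ_natural_right G.functor (F₂.functor.obj x) (α.natTrans.app x)
  associativity F₁ F₂ F₃ := by
    refine NatTrans.ext (funext fun G => hom₂_ext (P := P) (Q := R) fun x => ?_)
    exact LaxMonoidal.associativity G.functor _ _ _
  left_unitality F := by
    refine NatTrans.ext (funext fun G => hom₂_ext (P := P) (Q := R) fun x => ?_)
    exact LaxMonoidal.left_unitality G.functor _
  right_unitality F := by
    refine NatTrans.ext (funext fun G => hom₂_ext (P := P) (Q := R) fun x => ?_)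
    exact LaxMonoidal.right_unitality G.functor _

/-- `G ↦ (- ≫ G)` is strong monoidal. -/
def postcomposingMonoidal (P Q R : SymMon.{v, u}) : (postcomposing P Q R).CoreMonoidal where
  εIso := NatIso.ofComponents (fun F => nullLeft F R) (fun {F F'} α => by
    refine hom₂_ext (P := P) (Q := R) fun x => ?_
    rfl)
  μIso G₁ G₂ := NatIso.ofComponents (fun F => distribLeft F G₁ G₂) (fun {F F'} α => by
    refine hom₂_ext (P := P) (Q := R) fun x => ?_
    change (G₁.functor.map (α.natTrans.app x) ⊗ₘ G₂.functor.map (α.natTrans.app x)) ≫ 𝟙 _ =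
      𝟙 _ ≫ (G₁.functor.map (α.natTrans.app x) ⊗ₘ G₂.functor.map (α.natTrans.app x))
    simp)
  μIso_hom_natural_left {G G'} α G₂ := by
    refine NatTrans.ext (funext fun F => hom₂_ext (P := P) (Q := R) fun x => ?_)
    change (α.natTrans.app (F.functor.obj x) ▷ _) ≫ 𝟙 _ = 𝟙 _ ≫ (α.natTrans.app _ ▷ _)
    simp
  μIso_hom_natural_right {G G'} G₂ α := by
    refine NatTrans.ext (funext fun F => hom₂_ext (P := P) (Q := R) fun x => ?_)
    change (_ ◁ α.natTrans.app (F.functor.obj x)) ≫ 𝟙 _ = 𝟙 _ ≫ (_ ◁ α.natTrans.app _)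
    simp
  associativity G₁ G₂ G₃ := by
    refine NatTrans.ext (funext fun F => hom₂_ext (P := P) (Q := R) fun x => ?_)
    change 𝟙 _ ▷ (G₃.functor.obj (F.functor.obj x)) ≫ 𝟙 _ ≫ (α_ _ _ _).hom =
      (α_ _ _ _).hom ≫ (G₁.functor.obj (F.functor.obj x)) ◁ 𝟙 _ ≫ 𝟙 _
    simp
  left_unitality G := by
    refine NatTrans.ext (funext fun F => hom₂_ext (P := P) (Q := R) fun x => ?_)
    change (λ_ (G.functor.obj (F.functor.obj x))).hom =
      𝟙 _ ▷ (G.functor.obj (F.functor.obj x)) ≫ 𝟙 _ ≫ (λ_ _).hom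
    simp
  right_unitality G := by
    refine NatTrans.ext (funext fun F => hom₂_ext (P := P) (Q := R) fun x => ?_)
    change (ρ_ (G.functor.obj (F.functor.obj x))).hom =
      (G.functor.obj (F.functor.obj x)) ◁ 𝟙 _ ≫ 𝟙 _ ≫ (ρ_ _).hom
    simp

instance : BilinearComposition SymMon.{v, u} where
  homMonoidal := homMonoidal
  homSymmetric := homSymmetric
  precomposingBraided P Q R :=
    { toMonoidal := (precomposingMonoidal P Q R).toMonoidal
      braided F₁ F₂ := by
        refine NatTrans.ext (funext fun G => hom₂_ext (P := P) (Q := R) fun x => ?_)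
        exact LaxBraided.braided (F := G.functor) (F₁.functor.obj x) (F₂.functor.obj x) }
  postcomposingBraided P Q R :=
    { toMonoidal := (postcomposingMonoidal P Q R).toMonoidal
      braided G₁ G₂ := by
        refine NatTrans.ext (funext fun F => hom₂_ext (P := P) (Q := R) fun x => ?_)
        change 𝟙 _ ≫ (β_ (G₁.functor.obj (F.functor.obj x)) (G₂.functor.obj (F.functor.obj x))).hom
          = (β_ _ _).hom ≫ 𝟙 _
        simp }

theorem tensorμ_comp_tensorμ {D : Type u} [Category.{v} D] [MonoidalCategory D]
    [SymmetricCategory D] (X₁ X₂ Y₁ Y₂ : D) :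
    tensorμ X₁ X₂ Y₁ Y₂ ≫ tensorμ X₁ Y₁ X₂ Y₂ = 𝟙 _ := by
  have h : (β_ Y₁ X₂).hom = (β_ X₂ Y₁).inv := by
    rw [← cancel_epi (β_ X₂ Y₁).hom, SymmetricCategory.symmetry, Iso.hom_inv_id]
  have h' : tensorμ X₁ Y₁ X₂ Y₂ = tensorδ X₁ X₂ Y₁ Y₂ := by
    simp [tensorμ, tensorδ, h]
  rw [h', tensorμ_tensorδ]

/-- The `SMC`-category of symmetric monoidal categories. -/
instance : SMCategory SymMon.{v, u} where
  isMonoidal_precomposing_μ {P Q} R F F' :=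
    { unit := by
        refine hom₂_ext (P := P) (Q := R) fun x => ?_
        change ((λ_ (𝟙_ R.carrier)).inv ≫ (𝟙 (𝟙_ R.carrier) ⊗ₘ 𝟙 _)) ≫ (λ_ _).hom = 𝟙 _
        simp
      tensor G G' := by
        refine hom₂_ext (P := P) (Q := R) fun x => ?_
        change (tensorμ _ _ _ _ ≫ (𝟙 _ ⊗ₘ 𝟙 _)) ≫ tensorμ _ _ _ _ ≫
            (μ G.functor (F.functor.obj x) (F'.functor.obj x) ⊗ₘ μ G'.functor _ _) =
          (μ G.functor (F.functor.obj x) (F'.functor.obj x) ⊗ₘ μ G'.functor _ _) ≫ 𝟙 _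
        simp [reassoc_of% tensorμ_comp_tensorμ] }
  isMonoidal_postcomposing_μ P {Q R} G G' :=
    { unit := by
        refine hom₂_ext (P := P) (Q := R) fun x => ?_
        change ((λ_ _).inv ≫ (ε G.functor ⊗ₘ ε G'.functor)) ≫ 𝟙 _ =
          (λ_ _).inv ≫ (ε G.functor ⊗ₘ ε G'.functor)
        simp
      tensor F F' := by
        refine hom₂_ext (P := P) (Q := R) fun x => ?_
        change (tensorμ _ _ _ _ ≫ (μ G.functor (F.functor.obj x) (F'.functor.obj x) ⊗ₘ
            μ G'.functor (F.functor.obj x) (F'.functor.obj x))) ≫ 𝟙 _ =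
          (𝟙 _ ⊗ₘ 𝟙 _) ≫ tensorμ _ _ _ _ ≫ (μ G.functor _ _ ⊗ₘ μ G'.functor _ _)
        simp }
  isMonoidal_precomposing_ε P Q R :=
    { unit := by
        refine hom₂_ext (P := P) (Q := R) fun x => ?_
        change 𝟙 _ ≫ 𝟙 (𝟙_ R.carrier) = 𝟙 _
        simp
      tensor G G' := by
        refine hom₂_ext (P := P) (Q := R) fun x => ?_
        change (λ_ _).hom ≫ (λ_ _).inv ≫ (ε G.functor ⊗ₘ ε G'.functor) =
          (ε G.functor ⊗ₘ ε G'.functor) ≫ 𝟙 _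
        simp }
  isMonoidal_postcomposing_ε P Q R :=
    { unit := by
        refine hom₂_ext (P := P) (Q := R) fun x => ?_
        change 𝟙 _ ≫ 𝟙 (𝟙_ R.carrier) = 𝟙 _
        simp
      tensor F F' := by
        refine hom₂_ext (P := P) (Q := R) fun x => ?_
        change (λ_ (𝟙_ R.carrier)).hom ≫ 𝟙 _ = (𝟙 _ ⊗ₘ 𝟙 _) ≫ (λ_ _).hom
        simp }
  isMonoidal_associator_left P {Q R S} G H :=
    { unit := by
        refine hom₂_ext (P := P) (Q := S) fun x => ?_
        change (ε H.functor ≫ H.functor.map (ε G.functor)) ≫ 𝟙 _ =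
          ε H.functor ≫ H.functor.map (ε G.functor)
        simp
      tensor F F' := by
        refine hom₂_ext (P := P) (Q := S) fun x => ?_
        change (μ H.functor _ _ ≫ H.functor.map (μ G.functor (F.functor.obj x)
            (F'.functor.obj x))) ≫ 𝟙 _ = (𝟙 _ ⊗ₘ 𝟙 _) ≫ μ H.functor _ _ ≫ H.functor.map (μ G.functor _ _)
        simp }
  isMonoidal_associator_middle {P Q R S} F H :=
    { unit := by
        refine hom₂_ext (P := P) (Q := S) fun x => ?_
        change (ε H.functor ≫ H.functor.map (𝟙 _)) ≫ 𝟙 _ = 𝟙 _ ≫ ε H.functor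
        simp
      tensor F' F'' := by
        refine hom₂_ext (P := P) (Q := S) fun x => ?_
        change (μ H.functor _ _ ≫ H.functor.map (𝟙 (F'.functor.obj (F.functor.obj x) ⊗ F''.functor.obj (F.functor.obj x)))) ≫ 𝟙 _ =
          (𝟙 _ ⊗ₘ 𝟙 _) ≫ 𝟙 _ ≫ μ H.functor _ _
        simp }
  isMonoidal_associator_right {P Q R} F G S :=
    { unit := by
        refine hom₂_ext (P := P) (Q := S) fun x => ?_
        change 𝟙 (𝟙_ S.carrier) ≫ 𝟙 _ = 𝟙 _ ≫ 𝟙 _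
        simp
      tensor H H' := by
        refine hom₂_ext (P := P) (Q := S) fun x => ?_
        change 𝟙 (H.functor.obj (G.functor.obj (F.functor.obj x)) ⊗
           H'.functor.obj (G.functor.obj (F.functor.obj x))) ≫ 𝟙 _ = (𝟙 _ ⊗ₘ 𝟙 _) ≫ 𝟙 _ ≫ 𝟙 _
        simp }
  isMonoidal_leftUnitor P Q :=
    { unit := by
        refine hom₂_ext (P := P) (Q := Q) fun x => ?_
        change 𝟙 (𝟙_ Q.carrier) ≫ 𝟙 _ = 𝟙 _
        simp
      tensor F F' := by
        refine hom₂_ext (P := P) (Q := Q) fun x => ?_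
        change 𝟙 (F.functor.obj x ⊗ F'.functor.obj x) ≫ 𝟙 _ = (𝟙 _ ⊗ₘ 𝟙 _) ≫ 𝟙 _
        simp }
  isMonoidal_rightUnitor P Q :=
    { unit := by
        refine hom₂_ext (P := P) (Q := Q) fun x => ?_
        change 𝟙 (𝟙_ Q.carrier) ≫ 𝟙 _ = 𝟙 _
        simp
      tensor F F' := by
        refine hom₂_ext (P := P) (Q := Q) fun x => ?_
        change 𝟙 (F.functor.obj x ⊗ F'.functor.obj x) ≫ 𝟙 _ = (𝟙 _ ⊗ₘ 𝟙 _) ≫ 𝟙 _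
        simp }

end SymMon
end SymMon

/-!
### Permutative categories and strictly unital functors
-/

section Permutative

open MonoidalCategory Functor.LaxMonoidal

/-- A permutative category is a symmetric strict monoidal category: the tensor product is strictly
associative and unital, the associators and unitors being identities. -/
structure IsPermutative (P : SymMon.{v, u}) : Prop where
  tensor_assoc (x y z : P.carrier) : (x ⊗ y) ⊗ z = x ⊗ (y ⊗ z)
  unit_tensor (x : P.carrier) : 𝟙_ P.carrier ⊗ x = x
  tensor_unit (x : P.carrier) : x ⊗ 𝟙_ P.carrier = x
  associator_hom (x y z : P.carrier) : (α_ x y z).hom = eqToHom (tensor_assoc x y z)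
  leftUnitor_hom (x : P.carrier) : (λ_ x).hom = eqToHom (unit_tensor x)
  rightUnitor_hom (x : P.carrier) : (ρ_ x).hom = eqToHom (tensor_unit x)

/-- A (symmetric strong monoidal) functor is strictly unital if `F (𝟙_) = 𝟙_`, the unit constraint
being the identity. -/
def IsStrictlyUnital {P Q : SymMon.{v, u}} (F : P ⟶ Q) : Prop :=
  ∃ h : 𝟙_ Q.carrier = F.functor.obj (𝟙_ P.carrier), ε F.functor = eqToHom h

theorem eqToHom_tensorHom {C : Type u} [Category.{v} C] [MonoidalCategory C] {x x' y y' : C}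
    (h : x = x') (h' : y = y') :
    eqToHom h ⊗ₘ eqToHom h' = eqToHom (congrArg₂ (· ⊗ ·) h h') := by
  subst h h'
  simp

/-- Permutative categories and strictly unital functors are closed under the operations of `SymMon`. -/
def permUData : SubSMC SymMon.{v, u} where
  obj := IsPermutative
  hom := IsStrictlyUnital
  id_mem _ := ⟨rfl, rfl⟩
  comp_mem {P Q R} _ _ _ F G := by
    rintro ⟨h, hF⟩ ⟨h', hG⟩
    refine ⟨h'.trans (congrArg G.functor.obj h), ?_⟩
    change ε G.functor ≫ G.functor.map (ε F.functor) = _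
    rw [hF, hG, eqToHom_map, eqToHom_trans]
  zero_mem _ _ := ⟨rfl, rfl⟩
  add_mem {P Q} _ hQ F G := by
    rintro ⟨h, hF⟩ ⟨h', hG⟩
    refine ⟨(hQ.unit_tensor _).symm.trans (congrArg₂ (· ⊗ ·) h h'), ?_⟩
    change (λ_ _).inv ≫ (ε F.functor ⊗ₘ ε G.functor) = _
    have e : (λ_ (𝟙_ Q.carrier)).inv = eqToHom (hQ.unit_tensor _).symm := by
      rw [← cancel_epi (λ_ (𝟙_ Q.carrier)).hom, Iso.hom_inv_id, hQ.leftUnitor_hom, eqToHom_trans,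
        eqToHom_refl]
    rw [e, hF, hG, eqToHom_tensorHom, eqToHom_trans]
    rfl

/-- The `SMC`-category of permutative categories, strictly unital symmetric strong monoidal functors
and monoidal transformations. -/
abbrev PermU : Type (max (u + 1) (v + 1)) := permUData.{v, u}.Obj

/-- The inclusion of `PermU` into `SymMon`. -/
def inclusion : SMCFunctor PermU.{v, u} SymMon.{v, u} := permUData.inclusion

end Permutative

end SMC

universe v u

/-! Two facts about symmetric monoidal categories carry the theorem. Every symmetric monoidal
category is equivalent, through symmetric strong monoidal functors and monoidal isomorphisms, to a
permutative one whose objects are lists and whose tensor product is concatenation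
(`toStrictifyPseudoinverse`). Every symmetric strong monoidal functor is monoidally isomorphic to a
strictly unital one, obtained by changing its value at the unit object only
(`exists_isStrictlyUnital`). The rest is formal and applies to any locally full sub-`SMC`-category
`S` of an `SMC`-category `C` (`exists_biequivalence_inclusion`).

For each object `a` choose an equivalence `p a : a ⟶ T a` with `T a` in `S`, and for each `f : a ⟶
b` a 1-cell `T f` in `S` with an isomorphism `f ≫ p b ≅ p a ≫ T f`. Nothing else needs choosing.
Precomposition with `p a` is an equivalence of categories, so 2-cells between 1-cells out of `T a`
can be defined, and equations between them checked, after whiskering with `p a`. This determines `T`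
on 2-cells together with its comparisons, and makes `T` a pseudofunctor and `p` a strong
transformation from the identity to `T`. The monoidal structure is forced in the same way: `f ↦ T f`
followed by `p a ≫ -` is isomorphic to the symmetric strong monoidal functor `- ≫ p b`, and the
structure lifts through the fully faithful functor `p a ≫ -` (`FullyFaithfulLift.braided`). The
comparisons of `T` are monoidal because faithful strong monoidal functors reflect monoidality
(`isMonoidal_of_map_app`), and after whiskering they become pastings of associators, whiskerings and
the chosen isomorphisms.

A monoidal transformation whose components have pseudoinverses is an equivalence
(`equivalenceOfPseudoinverse`), by the same whiskering argument. Applied to `p` on `C` and to its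
restriction to `S`, this gives the two equivalences required. The second one lives in `S`, so for
`a` in `S` both `p a` and its pseudoinverse must lie in `S`. The embedding of a category in its
strictification is not strictly unital, so `p a` is taken to be the identity when `a` is already
permutative. -/

open MonoidalCategory Functor Functor.LaxMonoidal Functor.OplaxMonoidal Functor.Monoidal in
/-- A transformation is monoidal if its composite with a faithful strong monoidal functor is. -/
theorem isMonoidal_of_whiskerRight {C D E : Type*} [Category* C] [Category* D] [Category* E]
    [MonoidalCategory C] [MonoidalCategory D] [MonoidalCategory E] {F G : C ⥤ D}
    [F.LaxMonoidal] [G.LaxMonoidal] (τ : F ⟶ G) (L : D ⥤ E) [L.Monoidal] [L.Faithful]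
    [h : NatTrans.IsMonoidal (Functor.whiskerRight τ L)] : NatTrans.IsMonoidal τ where
  unit := by
    apply L.map_injective
    -- `ε L` is invertible, and composing with it produces the unit constraint of the composite with
    -- `L`; `μ L` plays the same role below.
    rw [← cancel_epi (ε L)]
    simpa using h.unit
  tensor X Y := by
    apply L.map_injective
    rw [← cancel_epi (μ L _ _)]
    simpa using h.tensor X Y

open Functor.LaxMonoidal in
/-- A transformation is monoidal if its composite with a faithful strong monoidal functor has the
components of a monoidal transformation. -/
theorem isMonoidal_of_map_app {C D E : Type*} [Category* C] [Category* D] [Category* E]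
    [MonoidalCategory C] [MonoidalCategory D] [MonoidalCategory E] {F G : C ⥤ D}
    [F.LaxMonoidal] [G.LaxMonoidal] (τ : F ⟶ G) (L : D ⥤ E) [L.Monoidal] [L.Faithful]
    (τ' : F ⋙ L ⟶ G ⋙ L) [NatTrans.IsMonoidal τ'] (h : ∀ x, L.map (τ.app x) = τ'.app x) :
    NatTrans.IsMonoidal τ :=
  have := SMC.isMonoidal_of_app (Functor.whiskerRight τ L) τ' h
  isMonoidal_of_whiskerRight τ L

/-! ### Lifting monoidal structures through fully faithful functors -/

namespace FullyFaithfulLift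

open MonoidalCategory Functor Functor.LaxMonoidal Functor.OplaxMonoidal Functor.Monoidal

section Monoidal

variable {C D E : Type*} [Category* C] [Category* D] [Category* E]
  [MonoidalCategory C] [MonoidalCategory D] [MonoidalCategory E]
  {H : C ⥤ D} {L : D ⥤ E} {K : C ⥤ E} [L.Monoidal] [L.Full] [L.Faithful] [K.Monoidal]

/-- The unit constraint of `H`, where `H ⋙ L` is isomorphic to a strong monoidal functor `K`. -/
noncomputable def unitIso (φ : K ≅ H ⋙ L) : 𝟙_ D ≅ H.obj (𝟙_ C) :=
  L.preimageIso ((Monoidal.εIso L).symm ≪≫ Monoidal.εIso K ≪≫ φ.app _)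

/-- The structure morphism of `H`, where `H ⋙ L` is isomorphic to a strong monoidal functor `K`. -/
noncomputable def tensorIso (φ : K ≅ H ⋙ L) (X Y : C) : H.obj X ⊗ H.obj Y ≅ H.obj (X ⊗ Y) :=
  L.preimageIso ((Monoidal.μIso L _ _).symm ≪≫ ((φ.app X).symm ⊗ᵢ (φ.app Y).symm) ≪≫
    Monoidal.μIso K X Y ≪≫ φ.app _)

/-- Together with `map_tensorIso_hom`, this lets the axioms for `H` be read off from those for `H ⋙
L`: under `L`, a lifted constraint is the constraint of `H ⋙ L` with that of `L` cancelled. -/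
theorem map_unitIso_hom (φ : K ≅ H ⋙ L) [(H ⋙ L).Monoidal] [NatTrans.IsMonoidal φ.hom] :
    L.map (unitIso φ).hom = η L ≫ ε (H ⋙ L) := by
  simp [unitIso, NatTrans.IsMonoidal.unit]

theorem map_tensorIso_hom (φ : K ≅ H ⋙ L) [(H ⋙ L).Monoidal] [NatTrans.IsMonoidal φ.hom]
    (X Y : C) : L.map (tensorIso φ X Y).hom = δ L _ _ ≫ μ (H ⋙ L) X Y := by
  simp only [tensorIso, Functor.preimageIso_hom, Functor.map_preimage, Iso.trans_hom]
  simp [NatTrans.IsMonoidal.tensor]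

/-- If `L` is fully faithful and strong monoidal and `H ⋙ L` is isomorphic to a strong monoidal
functor, then `H` is strong monoidal. -/
noncomputable def coreMonoidal (φ : K ≅ H ⋙ L) : H.CoreMonoidal :=
  -- `H ⋙ L` receives the structure of `K` along `φ`. Each axiom for `H` is then, under the faithful
  -- `L`, the corresponding axiom for this structure.
  letI := transport φ
  have hφ : NatTrans.IsMonoidal φ.hom :=
    { unit := (transport_ε φ).symm
      tensor X Y := by simp [transport_μ φ] }
  have hμ (X Y : C) := map_tensorIso_hom φ X Y
  { εIso := unitIso φ
    μIso := tensorIso φ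
    μIso_hom_natural_left f Z := by
      apply L.map_injective
      have h := μ_natural_left (H ⋙ L) f Z
      simp only [Functor.comp_map, Functor.comp_obj] at h
      simp only [Functor.map_comp, hμ, map_whiskerRight, Category.assoc, μ_δ_assoc, h]
    μIso_hom_natural_right Z f := by
      apply L.map_injective
      have h := μ_natural_right (H ⋙ L) Z f
      simp only [Functor.comp_map, Functor.comp_obj] at h
      simp only [Functor.map_comp, hμ, map_whiskerLeft, Category.assoc, μ_δ_assoc, h]
    associativity X Y Z := by
      apply L.map_injective
      have h := LaxMonoidal.associativity (H ⋙ L) X Y Z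
      simp only [Functor.comp_map, Functor.comp_obj] at h
      simp only [Functor.map_comp, hμ, map_whiskerRight, map_whiskerLeft, map_associator,
        MonoidalCategory.comp_whiskerRight, MonoidalCategory.whiskerLeft_comp, Category.assoc,
        μ_δ_assoc, h, whiskerLeft_μ_δ_assoc]
    left_unitality X := by
      apply L.map_injective
      have h := LaxMonoidal.left_unitality (H ⋙ L) X
      simp only [Functor.comp_map, Functor.comp_obj] at h
      simp [hμ, map_unitIso_hom, map_whiskerRight, map_leftUnitor, h]
    right_unitality X := by
      apply L.map_injective
      have h := LaxMonoidal.right_unitality (H ⋙ L) X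
      simp only [Functor.comp_map, Functor.comp_obj] at h
      simp [hμ, map_unitIso_hom, map_whiskerLeft, map_rightUnitor, h] }

end Monoidal

variable {C D E : Type*} [Category* C] [Category* D] [Category* E]
  [MonoidalCategory C] [MonoidalCategory D] [MonoidalCategory E]
  [BraidedCategory C] [BraidedCategory D] [BraidedCategory E]
  {H : C ⥤ D} {L : D ⥤ E} {K : C ⥤ E} [L.Braided] [L.Full] [L.Faithful] [K.Braided]

/-- If `L` is fully faithful and symmetric strong monoidal and `H ⋙ L` is isomorphic to a symmetric
strong monoidal functor, then `H` is symmetric strong monoidal. -/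
@[reducible]
noncomputable def braided (φ : K ≅ H ⋙ L) : H.Braided where
  toMonoidal := (coreMonoidal φ).toMonoidal
  braided X Y := by
    change (tensorIso φ X Y).hom ≫ H.map (β_ X Y).hom =
      (β_ (H.obj X) (H.obj Y)).hom ≫ (tensorIso φ Y X).hom
    apply L.map_injective
    have hβ := φ.hom.naturality (β_ X Y).hom
    simp only [Functor.comp_map] at hβ
    have hL : L.map (β_ (H.obj X) (H.obj Y)).hom = δ L _ _ ≫ (β_ _ _).hom ≫ μ L _ _ := by
      rw [← LaxBraided.braided, δ_μ_assoc]
    simp [tensorIso, hL, ← hβ]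

/-- The isomorphism `φ` is monoidal for the structure of `H` that it induces. -/
theorem isMonoidal (φ : K ≅ H ⋙ L) : letI := braided φ; NatTrans.IsMonoidal φ.hom :=
  letI := braided φ
  { unit := by
      change ε K ≫ φ.hom.app _ = ε L ≫ L.map (unitIso φ).hom
      simp [unitIso]
    tensor X Y := by
      change μ K X Y ≫ φ.hom.app _ = (φ.hom.app X ⊗ₘ φ.hom.app Y) ≫ μ L _ _ ≫
        L.map (tensorIso φ X Y).hom
      simp [tensorIso] }

end FullyFaithfulLift

/-! ### Inverting strong transformations componentwise -/

section PseudoinverseTransformation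

open Bicategory
open scoped Pseudofunctor.StrongTrans

/-- A pseudoinverse of a 1-cell. -/
structure Pseudoinverse {B : Type*} [Bicategory B] {a b : B} (p : a ⟶ b) where
  inv : b ⟶ a
  unit : p ≫ inv ≅ 𝟙 a
  counit : inv ≫ p ≅ 𝟙 b

/-- A pseudoinverse is pseudoinvertible. -/
@[simps]
def Pseudoinverse.symm {B : Type*} [Bicategory B] {a b : B} {p : a ⟶ b} (h : Pseudoinverse p) :
    Pseudoinverse h.inv where
  inv := p
  unit := h.counit
  counit := h.unit

/-- Precomposition with a pseudoinvertible 1-cell is an equivalence of categories. -/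
theorem Pseudoinverse.isEquivalence_precomp {B : Type*} [Bicategory B] {a b : B} {p : a ⟶ b}
    (h : Pseudoinverse p) (c : B) : ((precomposing a b c).obj p).IsEquivalence :=
  .mk' ((precomposing b a c).obj h.inv)
    ((leftUnitorNatIso b c).symm ≪≫ (precomposing b b c).mapIso h.counit.symm ≪≫
      associatorNatIsoRight h.inv p c)
    ((associatorNatIsoRight p h.inv c).symm ≪≫ (precomposing a a c).mapIso h.unit ≪≫
      leftUnitorNatIso a c)

/-- The faithful half of `isEquivalence_precomp`; it reduces equations of 2-cells to their whiskered
forms. -/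
theorem Pseudoinverse.whiskerLeft_injective {B : Type*} [Bicategory B] {a b c : B} {p : a ⟶ b}
    (h : Pseudoinverse p) {f g : b ⟶ c} {α β : f ⟶ g} (e : p ◁ α = p ◁ β) : α = β :=
  have := h.isEquivalence_precomp c
  ((precomposing a b c).obj p).map_injective e

/-- The 2-isomorphism with a given whiskering by a pseudoinvertible 1-cell. -/
noncomputable def Pseudoinverse.preimageIso {B : Type*} [Bicategory B] {a b c : B} {p : a ⟶ b}
    (h : Pseudoinverse p) {f g : b ⟶ c} (e : p ≫ f ≅ p ≫ g) : f ≅ g :=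
  have := h.isEquivalence_precomp c
  ((precomposing a b c).obj p).preimageIso e

theorem Pseudoinverse.whiskerLeft_preimageIso {B : Type*} [Bicategory B] {a b c : B} {p : a ⟶ b}
    (h : Pseudoinverse p) {f g : b ⟶ c} (e : p ≫ f ≅ p ≫ g) :
    p ◁ (h.preimageIso e).hom = e.hom :=
  have := h.isEquivalence_precomp c
  ((precomposing a b c).obj p).map_preimage e.hom

variable {B : Type*} [Bicategory B] {C : Type*} [Bicategory C] {F G : Pseudofunctor B C}
  (η : F ⟶ G) (h : ∀ a, Pseudoinverse (η.app a))

/-- The naturality constraint of the pseudoinverse of a strong transformation. -/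
noncomputable def invNaturality {a b : B} (f : a ⟶ b) :
    G.map f ≫ (h b).inv ≅ (h a).inv ≫ F.map f :=
  -- The path is `p a ≫ G f ≫ q b ≅ F f ≫ p b ≫ q b ≅ F f ≅ p a ≫ q a ≫ F f`, with `p` the
  -- components of `η` and `q` their pseudoinverses. Only the unit isomorphisms occur in it; the
  -- counits serve to make `p a ≫ -` fully faithful.
  (h a).preimageIso ((α_ _ _ _).symm ≪≫ whiskerRightIso (η.naturality f).symm _ ≪≫ α_ _ _ _ ≪≫
    whiskerLeftIso _ (h b).unit ≪≫ ρ_ _ ≪≫ (λ_ _).symm ≪≫ whiskerRightIso (h a).unit.symm _ ≪≫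
    α_ _ _ _)

theorem whiskerLeft_invNaturality {a b : B} (f : a ⟶ b) :
    η.app a ◁ (invNaturality η h f).hom = (α_ _ _ _).inv ≫ (η.naturality f).inv ▷ _ ≫
      (α_ _ _ _).hom ≫ F.map f ◁ (h b).unit.hom ≫ (ρ_ _).hom ≫ (λ_ _).inv ≫
      (h a).unit.inv ▷ F.map f ≫ (α_ _ _ _).hom := by
  simp [invNaturality, Pseudoinverse.whiskerLeft_preimageIso]

/-- With the constraint of `η` moved to the left, only the unit isomorphisms remain on the right,
and 2-cells of `F` slide past these by interchange. This is the form used for all three axioms of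
`invStrongTrans`. -/
theorem naturality_comp_whiskerLeft_invNaturality {a b : B} (f : a ⟶ b) :
    (η.naturality f).hom ▷ (h b).inv ≫ (α_ _ _ _).hom ≫ η.app a ◁ (invNaturality η h f).hom =
      (α_ _ _ _).hom ≫ F.map f ◁ (h b).unit.hom ≫ (ρ_ _).hom ≫ (λ_ _).inv ≫
      (h a).unit.inv ▷ F.map f ≫ (α_ _ _ _).hom := by
  rw [whiskerLeft_invNaturality]
  simp [← comp_whiskerRight_assoc]

/-- A strong transformation with pseudoinvertible components has a pseudoinverse. -/
noncomputable def invStrongTrans : G ⟶ F where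
  app a := (h a).inv
  naturality f := invNaturality η h f
  naturality_naturality {a b f g} β := by
    -- Whiskering with `η.app a` loses nothing, and neither does prefixing the invertible constraint
    -- of `η`. After both, `e` rewrites the constraint of the inverse, and the axiom follows from
    -- the matching axiom of `η`.
    apply (h a).whiskerLeft_injective
    rw [whiskerLeft_comp, whiskerLeft_comp, ← cancel_epi (α_ _ _ _).hom,
      ← cancel_epi ((η.naturality f).hom ▷ (h b).inv)]
    have e {a b : B} (f : a ⟶ b) := naturality_comp_whiskerLeft_invNaturality η h f
    calc _ = ((η.naturality f).hom ≫ η.app a ◁ G.map₂ β) ▷ (h b).inv ≫ (α_ _ _ _).hom ≫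
            η.app a ◁ (invNaturality η h g).hom := by simp
      _ = F.map₂ β ▷ η.app b ▷ (h b).inv ≫
          ((η.naturality g).hom ▷ (h b).inv ≫ (α_ _ _ _).hom ≫
            η.app a ◁ (invNaturality η h g).hom) := by
        rw [← η.naturality_naturality, comp_whiskerRight, Category.assoc]
      _ = (α_ _ _ _).hom ≫ (F.map₂ β ▷ (η.app b ≫ (h b).inv) ≫ F.map g ◁ (h b).unit.hom) ≫
          (ρ_ _).hom ≫ (λ_ _).inv ≫ (h a).unit.inv ▷ F.map g ≫ (α_ _ _ _).hom := by
        rw [e]; simp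
      _ = (α_ _ _ _).hom ≫ F.map f ◁ (h b).unit.hom ≫ (ρ_ _).hom ≫ (λ_ _).inv ≫
          (𝟙 _ ◁ F.map₂ β ≫ (h a).unit.inv ▷ F.map g) ≫ (α_ _ _ _).hom := by
        rw [← whisker_exchange]; simp
      _ = ((η.naturality f).hom ▷ (h b).inv ≫ (α_ _ _ _).hom ≫
            η.app a ◁ (invNaturality η h f).hom) ≫ η.app a ◁ (h a).inv ◁ F.map₂ β := by
        rw [whisker_exchange, e]; simp
      _ = _ := by simp
  naturality_id a := by
    apply (h a).whiskerLeft_injective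
    rw [whiskerLeft_comp, whiskerLeft_comp, ← cancel_epi (α_ _ _ _).hom,
      ← cancel_epi ((η.naturality (𝟙 a)).hom ▷ (h a).inv)]
    have e {a b : B} (f : a ⟶ b) := naturality_comp_whiskerLeft_invNaturality η h f
    calc _ = ((η.naturality (𝟙 a)).hom ▷ (h a).inv ≫ (α_ _ _ _).hom ≫
            η.app a ◁ (invNaturality η h (𝟙 a)).hom) ≫ η.app a ◁ (h a).inv ◁ (F.mapId a).hom := by
          simp
      _ = (α_ _ _ _).hom ≫ F.map (𝟙 a) ◁ (h a).unit.hom ≫ (ρ_ _).hom ≫ (λ_ _).inv ≫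
            ((h a).unit.inv ▷ F.map (𝟙 a) ≫ (η.app a ≫ (h a).inv) ◁ (F.mapId a).hom) ≫
             (α_ _ _ _).hom := by
        rw [e]; simp
      _ = (α_ _ _ _).hom ≫ (F.map (𝟙 a) ◁ (h a).unit.hom ≫ (F.mapId a).hom ▷ _) ≫
            (ρ_ _).hom ≫ (λ_ _).inv ≫ (h a).unit.inv ▷ 𝟙 _ ≫ (α_ _ _ _).hom := by
        rw [← whisker_exchange]; simp
      _ = (F.mapId a).hom ▷ η.app a ▷ (h a).inv ≫ (λ_ _).hom ▷ _ ≫ (h a).unit.hom ≫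
            (h a).unit.inv ≫ (ρ_ _).inv ≫ (α_ _ _ _).hom := by
        rw [whisker_exchange]; simp
      _ = ((F.mapId a).hom ▷ η.app a ≫ (λ_ _).hom ≫ (ρ_ _).inv) ▷ (h a).inv ≫
            (α_ _ _ _).hom ≫ η.app a ◁ ((λ_ _).hom ≫ (ρ_ _).inv) := by
        simp
      _ = _ := by
        rw [← η.naturality_id]; simp
  naturality_comp {a b c} f g := by
    apply (h a).whiskerLeft_injective
    rw [whiskerLeft_comp, ← cancel_epi (α_ _ _ _).hom,
      ← cancel_epi ((η.naturality (f ≫ g)).hom ▷ (h c).inv)]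
    have e {a b : B} (f : a ⟶ b) := naturality_comp_whiskerLeft_invNaturality η h f
    calc _ = ((η.naturality (f ≫ g)).hom ▷ (h c).inv ≫ (α_ _ _ _).hom ≫
            η.app a ◁ (invNaturality η h (f ≫ g)).hom) ≫
            η.app a ◁ (h a).inv ◁ (F.mapComp f g).hom := by
          simp
      _ = (α_ _ _ _).hom ≫ F.map (f ≫ g) ◁ (h c).unit.hom ≫ (ρ_ _).hom ≫ (λ_ _).inv ≫
            ((h a).unit.inv ▷ F.map (f ≫ g) ≫ (η.app a ≫ (h a).inv) ◁ (F.mapComp f g).hom) ≫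
             (α_ _ _ _).hom := by
        rw [e]; simp
      _ = (α_ _ _ _).hom ≫ (F.map (f ≫ g) ◁ (h c).unit.hom ≫ (F.mapComp f g).hom ▷ _) ≫
            (ρ_ _).hom ≫ (λ_ _).inv ≫ (h a).unit.inv ▷ _ ≫ (α_ _ _ _).hom := by
        rw [← whisker_exchange]; simp
      _ = (F.mapComp f g).hom ▷ η.app c ▷ (h c).inv ⊗≫ F.map f ◁ ((α_ _ _ _).hom ≫
            F.map g ◁ (h c).unit.hom ≫ (ρ_ _).hom ≫ (λ_ _).inv) ⊗≫
            (h a).unit.inv ▷ F.map f ▷ F.map g ⊗≫ 𝟙 _ := by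
        rw [whisker_exchange]; bicategory
      -- A cancelling pair at the middle object `b` is inserted, so that the path splits into one
      -- instance of `e` for `g` and one for `f`.
      _ = (F.mapComp f g).hom ▷ η.app c ▷ (h c).inv ⊗≫ F.map f ◁ ((α_ _ _ _).hom ≫
            F.map g ◁ (h c).unit.hom ≫ (ρ_ _).hom ≫ (λ_ _).inv) ⊗≫
            F.map f ◁ ((h b).unit.inv ≫ (h b).unit.hom) ▷ F.map g ⊗≫
            (h a).unit.inv ▷ F.map f ▷ F.map g ⊗≫ 𝟙 _ := by
        rw [Iso.inv_hom_id]; bicategory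
      _ = (F.mapComp f g).hom ▷ η.app c ▷ (h c).inv ⊗≫ F.map f ◁ ((α_ _ _ _).hom ≫
            F.map g ◁ (h c).unit.hom ≫ (ρ_ _).hom ≫ (λ_ _).inv ≫ (h b).unit.inv ▷ _ ≫
              (α_ _ _ _).hom) ⊗≫ ((α_ _ _ _).hom ≫ F.map f ◁ (h b).unit.hom ≫ (ρ_ _).hom ≫
              (λ_ _).inv ≫ (h a).unit.inv ▷ F.map f ≫ (α_ _ _ _).hom) ▷ F.map g ⊗≫ 𝟙 _ := by
        bicategory
      _ = (F.mapComp f g).hom ▷ η.app c ▷ (h c).inv ⊗≫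
            F.map f ◁ (η.naturality g).hom ▷ (h c).inv ⊗≫
            ((F.map f ≫ η.app b) ◁ (invNaturality η h g).hom ≫
              (η.naturality f).hom ▷ ((h b).inv ≫ F.map g)) ⊗≫
             η.app a ◁ (invNaturality η h f).hom ▷ F.map g ⊗≫ 𝟙 _ := by
        rw [← e, ← e]; bicategory
      _ = ((F.mapComp f g).hom ▷ η.app c ≫ (α_ _ _ _).hom ≫ F.map f ◁ (η.naturality g).hom ≫
            (α_ _ _ _).inv ≫ (η.naturality f).hom ▷ G.map g ≫ (α_ _ _ _).hom) ▷ (h c).inv ⊗≫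
            η.app a ◁ G.map f ◁ (invNaturality η h g).hom ⊗≫
             η.app a ◁ (invNaturality η h f).hom ▷ F.map g ⊗≫ 𝟙 _ := by
        rw [whisker_exchange]; bicategory
      _ = _ := by
        rw [← η.naturality_comp]; bicategory

end PseudoinverseTransformation

/-! ### Inverting monoidal transformations -/

/-- A transformation which becomes a pasting of monoidal transformations after composition with a
faithful strong monoidal functor is monoidal. -/
theorem isMonoidal_of_map_app_paste {A : Type*} [Category* A] [MonoidalCategory A]
    {X : Type*} [Category* X] [MonoidalCategory X] {Y : Type*} [Category* Y] [MonoidalCategory Y]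
    {Z : Type*} [Category* Z] [MonoidalCategory Z] {W : Type*} [Category* W] [MonoidalCategory W]
    {V : Type*} [Category* V] [MonoidalCategory V]
    {G : A ⥤ X} {Q : X ⥤ Y} {P : Y ⥤ Z} {P' : X ⥤ W} {Q' : W ⥤ Z} {F : A ⥤ V} {K : V ⥤ W}
    {R : V ⥤ Y} [G.LaxMonoidal] [Q.LaxMonoidal] [P.Monoidal] [P.Faithful] [P'.LaxMonoidal]
    [Q'.LaxMonoidal] [F.LaxMonoidal] [K.LaxMonoidal] [R.LaxMonoidal]
    (m : Q ⋙ P ⟶ P' ⋙ Q') (σ : G ⋙ P' ⟶ F ⋙ K) (l : K ⋙ Q' ⟶ R ⋙ P)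
    [NatTrans.IsMonoidal m] [NatTrans.IsMonoidal σ] [NatTrans.IsMonoidal l]
    (τ : G ⋙ Q ⟶ F ⋙ R)
    (h : ∀ x, P.map (τ.app x) = m.app (G.obj x) ≫ Q'.map (σ.app x) ≫ l.app (F.obj x)) :
    NatTrans.IsMonoidal τ :=
  isMonoidal_of_map_app τ P ((Functor.associator G Q P).hom ≫ Functor.whiskerLeft G m ≫
    (Functor.associator G P' Q').inv ≫ Functor.whiskerRight σ Q' ≫ (Functor.associator F K Q').hom ≫
    Functor.whiskerLeft F l ≫ (Functor.associator F R P).inv) (fun x => by simp [h])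

section MonoidalPseudoinverse

open Bicategory SMC
open scoped Pseudofunctor.StrongTrans

variable {C : Type*} [Bicategory C] [SMCategory C]

/-- Whiskering with a 2-cell is a monoidal transformation `f ≫ - ⟶ f' ≫ -`. -/
instance isMonoidal_precomposing_map {a b : C} (c : C) {f f' : a ⟶ b} (α : f ⟶ f') :
    NatTrans.IsMonoidal ((precomposing a b c).map α) where
  -- The constraints of `f ≫ -` are the components at `f` of those of `postcomposing`, so
  -- monoidality in one variable is naturality in the other.
  unit := (Functor.LaxMonoidal.ε (postcomposing a b c)).naturality α |>.symm.trans
    (Category.id_comp _)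
  tensor g g' := ((Functor.LaxMonoidal.μ (postcomposing a b c) g g').naturality α).symm

/-- Whiskering with a 2-cell is a monoidal transformation `- ≫ g ⟶ - ≫ g'`. -/
instance isMonoidal_postcomposing_map (a : C) {b c : C} {g g' : b ⟶ c} (α : g ⟶ g') :
    NatTrans.IsMonoidal ((postcomposing a b c).map α) where
  unit := (Functor.LaxMonoidal.ε (precomposing a b c)).naturality α |>.symm.trans
    (Category.id_comp _)
  tensor f f' := ((Functor.LaxMonoidal.μ (precomposing a b c) f f').naturality α).symm

variable {B : Type*} [Bicategory B] [SMCategory B] {F G : SMCFunctor B C}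

/-- A monoidal transformation with pseudoinvertible components has a pseudoinverse. -/
noncomputable def invMonoidalTrans (η : MonoidalTrans F G)
    (h : ∀ a, Pseudoinverse (η.toStrongTrans.app a)) : MonoidalTrans G F where
  toStrongTrans := invStrongTrans η.toStrongTrans h
  isMonoidal a b := by
    have := (h a).isEquivalence_precomp (F.toPseudofunctor.obj b)
    -- `l` is the part of `whiskerLeft_invNaturality` that follows the constraint of `η`, as a
    -- transformation in the 1-cell of `F`. Its factors are unitors, associators and whiskerings by
    -- fixed 2-cells, all of them monoidal.
    let l : (postcomposing _ _ _).obj (η.toStrongTrans.app b) ⋙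
          (postcomposing _ _ _).obj (h b).inv ⟶
        (precomposing _ _ (F.toPseudofunctor.obj b)).obj (h a).inv ⋙
          (precomposing _ _ _).obj (η.toStrongTrans.app a) :=
      (associatorNatIsoLeft _ (η.toStrongTrans.app b) (h b).inv).hom ≫
        (postcomposing _ _ _).map (h b).unit.hom ≫ (rightUnitorNatIso _ _).hom ≫
        (leftUnitorNatIso _ _).inv ≫ (precomposing _ _ _).map (h a).unit.inv ≫
        (associatorNatIsoRight (η.toStrongTrans.app a) (h a).inv _).hom
    have hl : NatTrans.IsMonoidal l := inferInstance
    exact isMonoidal_of_map_app_paste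
      (associatorNatIsoMiddle (η.toStrongTrans.app a) (h b).inv).inv
      (strongTransIso η.toStrongTrans a b).inv l _
      (whiskerLeft_invNaturality η.toStrongTrans h)

/-- The composite of a monoidal transformation with its pseudoinverse is isomorphic to the
identity. -/
noncomputable def compInvMonoidalTransIso (η : F ⟶ G)
    (h : ∀ a, Pseudoinverse (η.toStrongTrans.app a)) : η ≫ invMonoidalTrans η h ≅ 𝟙 F :=
  modIsoMk (Pseudofunctor.StrongTrans.isoMk (fun a => (h a).unit) (fun {a b} f => by
    refine .trans ?_ (congrArg (· ≫ (h a).unit.hom ▷ F.toPseudofunctor.map f)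
      (Pseudofunctor.StrongTrans.categoryStruct_comp_naturality_hom η.toStrongTrans
        (invStrongTrans η.toStrongTrans h) f)).symm
    have e := naturality_comp_whiskerLeft_invNaturality η.toStrongTrans h f
    change F.toPseudofunctor.map f ◁ (h b).unit.hom ≫ ((ρ_ _).hom ≫ (λ_ _).inv) =
      ((α_ _ _ _).inv ≫ (η.toStrongTrans.naturality f).hom ▷ (h b).inv ≫ (α_ _ _ _).hom ≫
        η.toStrongTrans.app a ◁ (invNaturality η.toStrongTrans h f).hom ≫ (α_ _ _ _).inv) ≫
        (h a).unit.hom ▷ F.toPseudofunctor.map f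
    simp only [Category.assoc]
    rw [reassoc_of% e]
    simp [← comp_whiskerRight]))

/-- A monoidal transformation with pseudoinvertible components is an equivalence. -/
noncomputable def equivalenceOfPseudoinverse (η : F ⟶ G)
    (h : ∀ a, Pseudoinverse (η.toStrongTrans.app a)) : F ≌ G :=
  -- The construction gives an isomorphism on one side only. Applied a second time, to `θ`, it gives
  -- `ι` with `θ ≫ ι ≅ 𝟙 G`; then `η ≅ η ≫ θ ≫ ι ≅ ι`, so `θ` is inverse to `η` on both sides.
  let θ : G ⟶ F := invMonoidalTrans η h
  let hθ (a) : Pseudoinverse (θ.toStrongTrans.app a) := (h a).symm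
  let ι : F ⟶ G := invMonoidalTrans θ hθ
  let e₁ : η ≫ θ ≅ 𝟙 F := compInvMonoidalTransIso η h
  let e₂ : θ ≫ ι ≅ 𝟙 G := compInvMonoidalTransIso θ hθ
  let e : η ≅ ι := (ρ_ η).symm ≪≫ whiskerLeftIso η e₂.symm ≪≫ (α_ _ _ _).symm ≪≫
    whiskerRightIso e₁ ι ≪≫ λ_ ι
  Equivalence.mkOfAdjointifyCounit e₁.symm (whiskerLeftIso θ e ≪≫ e₂)

end MonoidalPseudoinverse

/-! ### The pseudofunctor determined by a choice of equivalent objects and 1-cells -/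

section Replacement

open Bicategory SMC

/-- The 2-cell with a given whiskering by a pseudoinvertible 1-cell. -/
noncomputable def Pseudoinverse.preimage {B : Type*} [Bicategory B] {a b c : B} {p : a ⟶ b}
    (h : Pseudoinverse p) {f g : b ⟶ c} (e : p ≫ f ⟶ p ≫ g) : f ⟶ g :=
  have := h.isEquivalence_precomp c
  ((precomposing a b c).obj p).preimage e

theorem Pseudoinverse.whiskerLeft_preimage {B : Type*} [Bicategory B] {a b c : B} {p : a ⟶ b}
    (h : Pseudoinverse p) {f g : b ⟶ c} (e : p ≫ f ⟶ p ≫ g) : p ◁ h.preimage e = e :=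
  have := h.isEquivalence_precomp c
  ((precomposing a b c).obj p).map_preimage e

/-- A replacement of each object by an equivalent one and of each 1-cell by a 1-cell corresponding
to it under these equivalences. -/
structure Replacement (C : Type*) [Bicategory C] where
  obj : C → C
  hom (a : C) : a ⟶ obj a
  pinv (a : C) : Pseudoinverse (hom a)
  map {a b : C} (f : a ⟶ b) : obj a ⟶ obj b
  iso {a b : C} (f : a ⟶ b) : f ≫ hom b ≅ hom a ≫ map f

namespace Replacement

section Pseudofunctor

variable {C : Type*} [Bicategory C] (T : Replacement C)

/-- The action on 2-cells. -/
noncomputable def map₂ {a b : C} {f g : a ⟶ b} (θ : f ⟶ g) : T.map f ⟶ T.map g :=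
  (T.pinv a).preimage ((T.iso f).inv ≫ θ ▷ T.hom b ≫ (T.iso g).hom)

/-- The comparison for identities. -/
noncomputable def mapId (a : C) : T.map (𝟙 a) ≅ 𝟙 (T.obj a) :=
  (T.pinv a).preimageIso ((T.iso (𝟙 a)).symm ≪≫ λ_ _ ≪≫ (ρ_ _).symm)

/-- The comparison for composites. -/
noncomputable def mapComp {a b c : C} (f : a ⟶ b) (g : b ⟶ c) :
    T.map (f ≫ g) ≅ T.map f ≫ T.map g :=
  (T.pinv a).preimageIso ((T.iso (f ≫ g)).symm ≪≫ α_ _ _ _ ≪≫ whiskerLeftIso f (T.iso g) ≪≫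
    (α_ _ _ _).symm ≪≫ whiskerRightIso (T.iso f) (T.map g) ≪≫ α_ _ _ _)

/-- The factorization along which `smcFunctor` proves the comparison monoidal: with `f` or `g`
fixed, each factor is a monoidal transformation in the other. -/
theorem whiskerLeft_mapComp {a b c : C} (f : a ⟶ b) (g : b ⟶ c) :
    T.hom a ◁ (T.mapComp f g).hom = (T.iso (f ≫ g)).inv ≫ (α_ _ _ _).hom ≫ f ◁ (T.iso g).hom ≫
      (α_ _ _ _).inv ≫ (T.iso f).hom ▷ T.map g ≫ (α_ _ _ _).hom := by
  simp [mapComp, Pseudoinverse.whiskerLeft_preimageIso]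

/-- This and the next two equations say that the isomorphisms `T.iso` form a strong transformation
from the identity. By `hom_ext` they also characterize `map₂`, `mapId` and `mapComp`, and the
pseudofunctor axioms are deduced from them. -/
theorem iso_comp_map₂ {a b : C} {f g : a ⟶ b} (θ : f ⟶ g) :
    (T.iso f).hom ≫ T.hom a ◁ T.map₂ θ = θ ▷ T.hom b ≫ (T.iso g).hom := by
  simp [map₂, Pseudoinverse.whiskerLeft_preimage]

theorem iso_comp_mapId (a : C) :
    (T.iso (𝟙 a)).hom ≫ T.hom a ◁ (T.mapId a).hom = (λ_ _).hom ≫ (ρ_ _).inv := by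
  simp [mapId, Pseudoinverse.whiskerLeft_preimageIso]

theorem iso_comp_mapComp {a b c : C} (f : a ⟶ b) (g : b ⟶ c) :
    (T.iso (f ≫ g)).hom ≫ T.hom a ◁ (T.mapComp f g).hom = (α_ _ _ _).hom ≫ f ◁ (T.iso g).hom ≫
      (α_ _ _ _).inv ≫ (T.iso f).hom ▷ T.map g ≫ (α_ _ _ _).hom := by
  simp [mapComp, Pseudoinverse.whiskerLeft_preimageIso]

/-- Faithfulness of precomposition with `T.hom a`; the prefix `T.iso f` is invertible and puts both
sides in the shape of the three equations above. -/
theorem hom_ext {a b : C} {f : a ⟶ b} {x : T.obj a ⟶ T.obj b} {θ θ' : T.map f ⟶ x}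
    (h : (T.iso f).hom ≫ T.hom a ◁ θ = (T.iso f).hom ≫ T.hom a ◁ θ') : θ = θ' :=
  (T.pinv a).whiskerLeft_injective ((cancel_epi _).1 h)

/-- The pseudofunctor of a replacement, which is equivalent to the identity. -/
noncomputable def pseudofunctor : Pseudofunctor C C where
  obj := T.obj
  map := T.map
  map₂ := T.map₂
  mapId := T.mapId
  mapComp := T.mapComp
  map₂_id f := T.hom_ext (by simp [iso_comp_map₂])
  map₂_comp θ θ' := T.hom_ext (by simp [iso_comp_map₂, reassoc_of% T.iso_comp_map₂])
  map₂_whisker_left {a b c} f g g' θ := by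
    rw [← Category.assoc, Iso.eq_comp_inv]
    apply T.hom_ext
    calc _ = ((T.iso (f ≫ g)).hom ≫ T.hom a ◁ T.map₂ (f ◁ θ)) ≫
            T.hom a ◁ (T.mapComp f g').hom := by simp
      _ = (α_ _ _ _).hom ≫ f ◁ (θ ▷ T.hom c ≫ (T.iso g').hom) ≫
            (α_ _ _ _).inv ≫ (T.iso f).hom ▷ T.map g' ≫ (α_ _ _ _).hom := by
        rw [iso_comp_map₂, Category.assoc, iso_comp_mapComp]
        simp
      _ = (α_ _ _ _).hom ≫ f ◁ (T.iso g).hom ≫ (α_ _ _ _).inv ≫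
            ((f ≫ T.hom b) ◁ T.map₂ θ ≫ (T.iso f).hom ▷ T.map g') ≫ (α_ _ _ _).hom := by
        rw [← iso_comp_map₂]
        simp
      _ = ((α_ _ _ _).hom ≫ f ◁ (T.iso g).hom ≫ (α_ _ _ _).inv ≫ (T.iso f).hom ▷ T.map g ≫
            (α_ _ _ _).hom) ≫ T.hom a ◁ T.map f ◁ T.map₂ θ := by
        rw [whisker_exchange]
        simp
      _ = _ := by
        rw [← iso_comp_mapComp]
        simp
  map₂_whisker_right {a b c} f f' θ g := by
    rw [← Category.assoc, Iso.eq_comp_inv]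
    apply T.hom_ext
    calc _ = ((T.iso (f ≫ g)).hom ≫ T.hom a ◁ T.map₂ (θ ▷ g)) ≫
            T.hom a ◁ (T.mapComp f' g).hom := by simp
      _ = (α_ _ _ _).hom ≫ (θ ▷ (g ≫ T.hom c) ≫ f' ◁ (T.iso g).hom) ≫
            (α_ _ _ _).inv ≫ (T.iso f').hom ▷ T.map g ≫ (α_ _ _ _).hom := by
        rw [iso_comp_map₂, Category.assoc, iso_comp_mapComp]
        simp
      _ = (α_ _ _ _).hom ≫ f ◁ (T.iso g).hom ≫ (α_ _ _ _).inv ≫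
            (θ ▷ T.hom b ≫ (T.iso f').hom) ▷ T.map g ≫ (α_ _ _ _).hom := by
        rw [← whisker_exchange]
        simp
      _ = ((α_ _ _ _).hom ≫ f ◁ (T.iso g).hom ≫ (α_ _ _ _).inv ≫ (T.iso f).hom ▷ T.map g ≫
            (α_ _ _ _).hom) ≫ T.hom a ◁ T.map₂ θ ▷ T.map g := by
        rw [← iso_comp_map₂]
        simp
      _ = _ := by
        rw [← iso_comp_mapComp]
        simp
  map₂_associator {a b c d} f g k := by
    -- The associativity axiom with inverses cleared: every comparison now points the way that
    -- `iso_comp_mapComp` describes.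
    have h : T.map₂ (α_ f g k).hom ≫ (T.mapComp f (g ≫ k)).hom ≫ T.map f ◁ (T.mapComp g k).hom =
        (T.mapComp (f ≫ g) k).hom ≫ (T.mapComp f g).hom ▷ T.map k ≫ (α_ _ _ _).hom := by
      apply T.hom_ext
      calc _ = ((T.iso ((f ≫ g) ≫ k)).hom ≫ T.hom a ◁ T.map₂ (α_ f g k).hom) ≫
              T.hom a ◁ (T.mapComp f (g ≫ k)).hom ≫ T.hom a ◁ T.map f ◁ (T.mapComp g k).hom := by
            simp
        _ = (α_ _ _ _).hom ▷ T.hom d ≫ (α_ _ _ _).hom ≫ f ◁ (T.iso (g ≫ k)).hom ≫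
              (α_ _ _ _).inv ≫ ((T.iso f).hom ▷ T.map (g ≫ k) ≫
                (T.hom a ≫ T.map f) ◁ (T.mapComp g k).hom) ≫ (α_ _ _ _).hom := by
          rw [iso_comp_map₂, Category.assoc, reassoc_of% (T.iso_comp_mapComp f (g ≫ k))]
          simp
        _ = (α_ _ _ _).hom ▷ T.hom d ≫ (α_ _ _ _).hom ≫ f ◁ ((T.iso (g ≫ k)).hom ≫
              T.hom b ◁ (T.mapComp g k).hom) ≫ (α_ _ _ _).inv ≫
              (T.iso f).hom ▷ (T.map g ≫ T.map k) ≫ (α_ _ _ _).hom := by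
          rw [← whisker_exchange]
          simp
        _ = (α_ _ _ _).hom ≫ (f ≫ g) ◁ (T.iso k).hom ≫ (α_ _ _ _).inv ≫
              ((α_ _ _ _).hom ≫ f ◁ (T.iso g).hom ≫ (α_ _ _ _).inv ≫ (T.iso f).hom ▷ T.map g ≫
                (α_ _ _ _).hom) ▷ T.map k ≫ (α_ _ _ _).hom ≫ T.hom a ◁ (α_ _ _ _).hom := by
          rw [iso_comp_mapComp]
          bicategory
        _ = ((α_ _ _ _).hom ≫ (f ≫ g) ◁ (T.iso k).hom ≫ (α_ _ _ _).inv ≫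
              (T.iso (f ≫ g)).hom ▷ T.map k ≫ (α_ _ _ _).hom) ≫
              T.hom a ◁ (T.mapComp f g).hom ▷ T.map k ≫ T.hom a ◁ (α_ _ _ _).hom := by
          rw [← iso_comp_mapComp]
          simp
        _ = _ := by
          rw [← iso_comp_mapComp]
          simp
    rw [← reassoc_of% h]
    simp
  map₂_left_unitor {a b} f := by
    apply T.hom_ext
    symm
    calc _ = ((T.iso (𝟙 a ≫ f)).hom ≫ T.hom a ◁ (T.mapComp (𝟙 a) f).hom) ≫
            T.hom a ◁ (T.mapId a).hom ▷ T.map f ≫ T.hom a ◁ (λ_ _).hom := by simp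
      _ = (α_ _ _ _).hom ≫ 𝟙 a ◁ (T.iso f).hom ≫ (α_ _ _ _).inv ≫
            ((T.iso (𝟙 a)).hom ≫ T.hom a ◁ (T.mapId a).hom) ▷ T.map f ≫
              (α_ _ _ _).hom ≫ T.hom a ◁ (λ_ _).hom := by
        rw [iso_comp_mapComp]
        simp
      _ = (λ_ f).hom ▷ T.hom b ≫ (T.iso f).hom := by
        rw [iso_comp_mapId]
        bicategory
      _ = _ := by rw [iso_comp_map₂]
  map₂_right_unitor {a b} f := by
    apply T.hom_ext
    symm
    calc _ = ((T.iso (f ≫ 𝟙 b)).hom ≫ T.hom a ◁ (T.mapComp f (𝟙 b)).hom) ≫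
            T.hom a ◁ T.map f ◁ (T.mapId b).hom ≫ T.hom a ◁ (ρ_ _).hom := by simp
      _ = (α_ _ _ _).hom ≫ f ◁ (T.iso (𝟙 b)).hom ≫ (α_ _ _ _).inv ≫
            ((T.iso f).hom ▷ T.map (𝟙 b) ≫ (T.hom a ≫ T.map f) ◁ (T.mapId b).hom) ≫
              (α_ _ _ _).hom ≫ T.hom a ◁ (ρ_ _).hom := by
        rw [iso_comp_mapComp]
        simp
      _ = (α_ _ _ _).hom ≫ f ◁ ((T.iso (𝟙 b)).hom ≫ T.hom b ◁ (T.mapId b).hom) ≫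
            (α_ _ _ _).inv ≫ (T.iso f).hom ▷ 𝟙 _ ≫ (α_ _ _ _).hom ≫ T.hom a ◁ (ρ_ _).hom := by
        rw [← whisker_exchange]
        simp
      _ = (ρ_ f).hom ▷ T.hom b ≫ (T.iso f).hom := by
        rw [iso_comp_mapId]
        bicategory
      _ = _ := by rw [iso_comp_map₂]

end Pseudofunctor

end Replacement
end Replacement

/-! ### The `SMC`-functor of a replacement -/

/-- A transformation which becomes a pasting of monoidal transformations after composition with a
faithful strong monoidal functor is monoidal. -/
theorem isMonoidal_of_map_app_paste₄ {A : Type*} [Category* A] [MonoidalCategory A]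
    {X : Type*} [Category* X] [MonoidalCategory X] {Y : Type*} [Category* Y] [MonoidalCategory Y]
    {Z : Type*} [Category* Z] [MonoidalCategory Z] {W : Type*} [Category* W] [MonoidalCategory W]
    {V : Type*} [Category* V] [MonoidalCategory V]
    {G : A ⥤ X} {M : X ⥤ Y} {P : Y ⥤ Z} {K : X ⥤ Z} {K' : A ⥤ W} {G' : W ⥤ Z} {N : A ⥤ V}
    {P' : V ⥤ W} {Q : V ⥤ Y} [G.LaxMonoidal] [M.LaxMonoidal] [P.Monoidal] [P.Faithful]
    [K.LaxMonoidal] [K'.LaxMonoidal] [G'.LaxMonoidal] [N.LaxMonoidal] [P'.LaxMonoidal]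
    [Q.LaxMonoidal]
    (s : M ⋙ P ⟶ K) (k : G ⋙ K ⟶ K' ⋙ G') (t : K' ⟶ N ⋙ P') (l : P' ⋙ G' ⟶ Q ⋙ P)
    [NatTrans.IsMonoidal s] [NatTrans.IsMonoidal k] [NatTrans.IsMonoidal t]
    [NatTrans.IsMonoidal l] (τ : G ⋙ M ⟶ N ⋙ Q)
    (h : ∀ x, P.map (τ.app x) =
      s.app (G.obj x) ≫ k.app x ≫ G'.map (t.app x) ≫ l.app (N.obj x)) :
    NatTrans.IsMonoidal τ :=
  isMonoidal_of_map_app τ P ((Functor.associator G M P).hom ≫ Functor.whiskerLeft G s ≫ k ≫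
    Functor.whiskerRight t G' ≫ (Functor.associator N P' G').hom ≫ Functor.whiskerLeft N l ≫
    (Functor.associator N Q P).inv) (fun x => by simp [h])

namespace Replacement

section SMC

open Bicategory SMC

variable {C : Type*} [Bicategory C] [SMCategory C] (T : Replacement C)

/-- `hom a` as a 1-cell to the value of the pseudofunctor. -/
noncomputable def unit (a : C) : a ⟶ T.pseudofunctor.obj a := T.hom a

/-- The pseudoinverse of `unit`. -/
noncomputable def unitPinv (a : C) : Pseudoinverse (T.unit a) := T.pinv a

/-- `iso f` in terms of the pseudofunctor. -/
noncomputable def unitIso {a b : C} (f : a ⟶ b) :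
    f ≫ T.unit b ≅ T.unit a ≫ T.pseudofunctor.map f := T.iso f

/-- The isomorphism `f ≫ hom b ≅ hom a ≫ map f`, natural in `f`. -/
noncomputable def natIso (a b : C) : (postcomposing a b (T.pseudofunctor.obj b)).obj (T.unit b) ≅
    T.pseudofunctor.mapFunctor a b ⋙
      (precomposing a (T.pseudofunctor.obj a) (T.pseudofunctor.obj b)).obj (T.unit a) :=
  NatIso.ofComponents T.iso (fun θ => (T.iso_comp_map₂ θ).symm)

noncomputable instance braided (a b : C) : (T.pseudofunctor.mapFunctor a b).Braided :=
  have := (T.unitPinv a).isEquivalence_precomp (T.pseudofunctor.obj b)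
  FullyFaithfulLift.braided (T.natIso a b)

instance isMonoidal_natIso (a b : C) : NatTrans.IsMonoidal (T.natIso a b).hom :=
  have := (T.unitPinv a).isEquivalence_precomp (T.pseudofunctor.obj b)
  FullyFaithfulLift.isMonoidal (T.natIso a b)

/-- The `SMC`-functor of a replacement. -/
noncomputable def smcFunctor : SMCFunctor C C where
  toPseudofunctor := T.pseudofunctor
  braided := T.braided
  isMonoidal_precomp {a b} f c :=
    have := (T.unitPinv a).isEquivalence_precomp (T.pseudofunctor.obj c)
    -- With `f` fixed, `T.iso g` is the varying part of `whiskerLeft_mapComp`, and `l` collects what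
    -- follows it: associators and whiskering with the fixed 2-cell `T.iso f`.
    let l : (precomposing b (T.pseudofunctor.obj b) (T.pseudofunctor.obj c)).obj (T.unit b) ⋙
          (precomposing a b _).obj f ⟶
        (precomposing (T.pseudofunctor.obj a) (T.pseudofunctor.obj b) (T.pseudofunctor.obj c)).obj
            (T.pseudofunctor.map f) ⋙
          (precomposing a (T.pseudofunctor.obj a) _).obj (T.unit a) :=
      (associatorNatIsoRight f (T.unit b) (T.pseudofunctor.obj c)).inv ≫
        (precomposing _ _ _).map (T.unitIso f).hom ≫
        (associatorNatIsoRight (T.unit a) (T.pseudofunctor.map f) (T.pseudofunctor.obj c)).hom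
    have hl : NatTrans.IsMonoidal l := inferInstance
    isMonoidal_of_map_app_paste₄ (T.natIso a c).inv (associatorNatIsoMiddle f (T.unit c)).hom
      (T.natIso b c).hom l _ (T.whiskerLeft_mapComp f)
  isMonoidal_postcomp a {b c} g :=
    have := (T.unitPinv a).isEquivalence_precomp (T.pseudofunctor.obj c)
    -- With `g` fixed the same composite is grouped differently: `T.iso f` varies, while whiskering
    -- with `T.iso g` precedes it and is absorbed in `k`.
    let k : (postcomposing a b c).obj g ⋙
          (postcomposing a c (T.pseudofunctor.obj c)).obj (T.unit c) ⟶
        (postcomposing a b (T.pseudofunctor.obj b)).obj (T.unit b) ⋙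
          (postcomposing a (T.pseudofunctor.obj b) (T.pseudofunctor.obj c)).obj
            (T.pseudofunctor.map g) :=
      (associatorNatIsoLeft a g (T.unit c)).hom ≫ (postcomposing _ _ _).map (T.unitIso g).hom ≫
        (associatorNatIsoLeft a (T.unit b) (T.pseudofunctor.map g)).inv
    have hk : NatTrans.IsMonoidal k := inferInstance
    isMonoidal_of_map_app_paste₄ (T.natIso a c).inv k (T.natIso a b).hom
      (associatorNatIsoMiddle (T.unit a) (T.pseudofunctor.map g)).hom _
      (fun f => by
        change T.hom a ◁ (T.mapComp f g).hom = (T.iso (f ≫ g)).inv ≫ ((α_ _ _ _).hom ≫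
          f ◁ (T.iso g).hom ≫ (α_ _ _ _).inv) ≫ (T.iso f).hom ▷ T.map g ≫ (α_ _ _ _).hom
        rw [whiskerLeft_mapComp, Category.assoc, Category.assoc])

end SMC

end Replacement

/-! ### Corestriction to a locally full sub-`SMC`-category -/

section SubSMC

open Bicategory SMC MonoidalCategory Functor.LaxMonoidal

variable {B : Type*} [Bicategory B] {C : Type*} [Bicategory C] [SMCategory B] [SMCategory C]

/-- A pseudofunctor with values in a locally full sub-bicategory. -/
def liftPseudofunctor (S : SubSMC C) (F : Pseudofunctor B C) (ho : ∀ b, S.obj (F.obj b))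
    (hm : ∀ {a b : B} (f : a ⟶ b), S.hom (F.map f)) : Pseudofunctor B S.Obj where
  obj b := ⟨F.obj b, ho b⟩
  map f := ⟨F.map f, hm f⟩
  -- By local fullness, membership has to be tested on 0-cells and 1-cells only; all 2-cells,
  -- constraints and equations are those of `F`.
  map₂ θ := F.map₂ θ
  mapId a := SubSMC.isoMk (F.mapId a)
  mapComp f g := SubSMC.isoMk (F.mapComp f g)
  map₂_id f := F.map₂_id f
  map₂_comp θ θ' := F.map₂_comp θ θ'
  map₂_whisker_left f _ _ θ := F.map₂_whisker_left f θ
  map₂_whisker_right θ g := F.map₂_whisker_right θ g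
  map₂_associator f g k := F.map₂_associator f g k
  map₂_left_unitor f := F.map₂_left_unitor f
  map₂_right_unitor f := F.map₂_right_unitor f

/-- A symmetric strong monoidal functor with values in a locally full sub-`SMC`-category. -/
instance liftBraided (S : SubSMC C) (F : SMCFunctor B C) (ho : ∀ b, S.obj (F.toPseudofunctor.obj b))
    (hm : ∀ {a b : B} (f : a ⟶ b), S.hom (F.toPseudofunctor.map f)) (a b : B) :
    ((liftPseudofunctor S F.toPseudofunctor ho hm).mapFunctor a b).Braided where
  toMonoidal := Functor.CoreMonoidal.toMonoidal
    { εIso := SubSMC.isoMk (Functor.Monoidal.εIso (F.toPseudofunctor.mapFunctor a b))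
      μIso f g := SubSMC.isoMk (Functor.Monoidal.μIso (F.toPseudofunctor.mapFunctor a b) f g)
      μIso_hom_natural_left θ g := μ_natural_left (F.toPseudofunctor.mapFunctor a b) θ g
      μIso_hom_natural_right g θ := μ_natural_right (F.toPseudofunctor.mapFunctor a b) g θ
      associativity f g k := associativity (F.toPseudofunctor.mapFunctor a b) f g k
      left_unitality f := left_unitality (F.toPseudofunctor.mapFunctor a b) f
      right_unitality f := right_unitality (F.toPseudofunctor.mapFunctor a b) f }
  braided f g := Functor.LaxBraided.braided (F := F.toPseudofunctor.mapFunctor a b) f g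

/-- An `SMC`-functor with values in a locally full sub-`SMC`-category. -/
def liftSMCFunctor (S : SubSMC C) (F : SMCFunctor B C) (ho : ∀ b, S.obj (F.toPseudofunctor.obj b))
    (hm : ∀ {a b : B} (f : a ⟶ b), S.hom (F.toPseudofunctor.map f)) : SMCFunctor B S.Obj where
  toPseudofunctor := liftPseudofunctor S F.toPseudofunctor ho hm
  braided := liftBraided S F ho hm
  isMonoidal_precomp f c :=
    have h := F.isMonoidal_precomp f c
    { unit := h.unit, tensor := h.tensor }
  isMonoidal_postcomp a _ _ g :=
    have h := F.isMonoidal_postcomp a g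
    { unit := h.unit, tensor := h.tensor }

end SubSMC

/-! ### A criterion for the inclusion of a sub-`SMC`-category to be a biequivalence -/

section Biequivalence

open Bicategory SMC
open Functor.LaxMonoidal (μ)

variable {C : Type*} [Bicategory C] [SMCategory C] (S : SubSMC C) (T : Replacement C)
  (ho : ∀ a, S.obj (T.obj a)) (hm : ∀ {a b : C} (f : a ⟶ b), S.hom (T.map f))

/-- The `SMC`-functor of a replacement by objects and 1-cells of a sub-`SMC`-category. -/
noncomputable def replacementSMCFunctor : SMCFunctor C S.Obj :=
  liftSMCFunctor S T.smcFunctor ho hm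

/-- The monoidal transformation from the identity of `C` to a replacement in a
sub-`SMC`-category. -/
noncomputable def toReplacement :
    MonoidalTrans (SMCFunctor.id C)
      ((replacementSMCFunctor S T ho hm).comp S.inclusion) where
  toStrongTrans :=
    { app a := T.hom a
      naturality f := T.iso f
      naturality_naturality θ := (T.iso_comp_map₂ θ).symm
      naturality_id a := by
        change (T.iso (𝟙 a)).hom ≫ T.hom a ◁ ((T.mapId a).hom ≫ 𝟙 _) =
          𝟙 (𝟙 a) ▷ T.hom a ≫ (λ_ _).hom ≫ (ρ_ _).inv
        simp [T.iso_comp_mapId]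
      naturality_comp {a b c} f g := by
        change (T.iso (f ≫ g)).hom ≫ T.hom a ◁ ((T.mapComp f g).hom ≫ 𝟙 _) =
          𝟙 (f ≫ g) ▷ T.hom c ≫ (α_ _ _ _).hom ≫ f ◁ (T.iso g).hom ≫
           (α_ _ _ _).inv ≫ (T.iso f).hom ▷ T.map g ≫ (α_ _ _ _).hom
        simp [T.iso_comp_mapComp] }
  isMonoidal a b :=
    have h := T.isMonoidal_natIso a b
    let P := (precomposing a (T.pseudofunctor.obj a) (T.pseudofunctor.obj b)).obj (T.unit a)
    let Q := (postcomposing a b (T.pseudofunctor.obj b)).obj (T.unit b)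
    let M := T.pseudofunctor.mapFunctor a b
    { unit := by
        change (Functor.LaxMonoidal.ε Q ≫ Q.map (𝟙 _)) ≫ (T.natIso a b).hom.app _ =
          Functor.LaxMonoidal.ε P ≫ P.map (𝟙 _ ≫ Functor.LaxMonoidal.ε M)
        rw [Q.map_id, Category.comp_id, Category.id_comp]
        exact h.unit
      tensor f g := by
        change (μ Q f g ≫ Q.map (𝟙 _)) ≫ (T.natIso a b).hom.app _ =
          MonoidalCategoryStruct.tensorHom ((T.natIso a b).hom.app f) ((T.natIso a b).hom.app g) ≫
            μ P (M.obj f) (M.obj g) ≫ P.map (𝟙 _ ≫ μ M f g)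
        rw [Q.map_id, Category.comp_id, Category.id_comp]
        exact h.tensor f g }

/-- The monoidal transformation from the identity of a sub-`SMC`-category to the restriction of a
replacement. -/
noncomputable def toRestrictedReplacement (hu : ∀ a : S.Obj, S.hom (T.hom a.val)) :
    MonoidalTrans (SMCFunctor.id S.Obj)
      (S.inclusion.comp (replacementSMCFunctor S T ho hm)) where
  toStrongTrans :=
    { app a := ⟨T.hom a.val, hu a⟩
      naturality f := SubSMC.isoMk (T.iso f.val)
      naturality_naturality θ := (T.iso_comp_map₂ (C := C) θ).symm
      naturality_id a := by
        change (T.iso (𝟙 a.val)).hom ≫ T.hom a.val ◁ (T.map₂ (𝟙 _) ≫ (T.mapId a.val).hom) =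
          𝟙 (𝟙 a.val) ▷ T.hom a.val ≫ (λ_ _).hom ≫ (ρ_ _).inv
        simp [T.iso_comp_mapId, reassoc_of% T.iso_comp_map₂ (𝟙 _)]
      naturality_comp {a b c} f g := by
        change (T.iso (f.val ≫ g.val)).hom ≫ T.hom a.val ◁
            (T.map₂ (𝟙 _) ≫ (T.mapComp f.val g.val).hom) =
          𝟙 (f.val ≫ g.val) ▷ T.hom c.val ≫ (α_ _ _ _).hom ≫ f.val ◁ (T.iso g.val).hom ≫
           (α_ _ _ _).inv ≫ (T.iso f.val).hom ▷ T.map g.val ≫ (α_ _ _ _).hom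
        simp [T.iso_comp_mapComp, reassoc_of% T.iso_comp_map₂ (𝟙 _)] }
  isMonoidal a b :=
    have h := T.isMonoidal_natIso a.val b.val
    let P := (precomposing a.val (T.pseudofunctor.obj a.val) (T.pseudofunctor.obj b.val)).obj
      (T.unit a.val)
    let Q := (postcomposing a.val b.val (T.pseudofunctor.obj b.val)).obj (T.unit b.val)
    let M := T.pseudofunctor.mapFunctor a.val b.val
    { unit := by
        change (Functor.LaxMonoidal.ε Q ≫ Q.map (𝟙 _)) ≫ (T.natIso a.val b.val).hom.app _ =
          Functor.LaxMonoidal.ε P ≫ P.map (Functor.LaxMonoidal.ε M ≫ M.map (𝟙 _))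
        rw [Q.map_id, M.map_id, Category.comp_id, Category.comp_id]
        exact h.unit
      tensor f g := by
        change (μ Q f.val g.val ≫ Q.map (𝟙 _)) ≫ (T.natIso a.val b.val).hom.app _ =
          MonoidalCategoryStruct.tensorHom ((T.natIso a.val b.val).hom.app f.val)
            ((T.natIso a.val b.val).hom.app g.val) ≫
            μ P (M.obj f.val) (M.obj g.val) ≫ P.map (μ M f.val g.val ≫ M.map (𝟙 _))
        rw [Q.map_id, M.map_id, Category.comp_id, Category.comp_id]
        exact h.tensor f.val g.val }

/-- The inclusion of a locally full sub-`SMC`-category is a biequivalence if every object is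
equivalent to one in it, by 1-cells in it when the object is in it already, and every 1-cell between
its objects is isomorphic to one in it. -/
theorem exists_biequivalence_inclusion
    (h₁ : ∀ a : C, ∃ (b : S.Obj) (p : a ⟶ b.val) (q : Pseudoinverse p),
      S.obj a → S.hom p ∧ S.hom q.inv)
    (h₂ : ∀ {a b : C} (f : a ⟶ b), S.obj a → S.obj b → ∃ g : a ⟶ b, S.hom g ∧ Nonempty (f ≅ g)) :
    ∃ e : Biequivalence S.Obj C, e.functor = S.inclusion := by
  choose b p q hS using h₁
  have h₃ {a a' : C} (f : a ⟶ a') : ∃ g : (b a).val ⟶ (b a').val,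
      S.hom g ∧ Nonempty (f ≫ p a' ≅ p a ≫ g) := by
    -- The conjugate of `f` by the chosen equivalences runs between objects of `S`, so `h₂` moves it
    -- into `S`; the unit `p a ≫ q a ≅ 𝟙` then gives the required square.
    obtain ⟨g, hg, ⟨e⟩⟩ := h₂ ((q a).inv ≫ f ≫ p a') (b a).property (b a').property
    exact ⟨g, hg, ⟨(λ_ _).symm ≪≫ whiskerRightIso (q a).unit.symm _ ≪≫ α_ _ _ _ ≪≫
      whiskerLeftIso (p a) e⟩⟩
  choose m hm φ using @h₃
  let T : Replacement C :=
    { obj a := (b a).val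
      hom := p
      pinv := q
      map := m
      iso f := (φ f).some }
  let J := replacementSMCFunctor S T (fun a => (b a).property) hm
  let η : SMCFunctor.id C ⟶ J.comp S.inclusion := toReplacement S T (fun a => (b a).property) hm
  let θ : SMCFunctor.id S.Obj ⟶ S.inclusion.comp J :=
    toRestrictedReplacement S T (fun a => (b a).property) hm (fun a => (hS a.val a.property).1)
  have hη (a) : Pseudoinverse (η.toStrongTrans.app a) := q a
  -- This is where the chosen pseudoinverses must lie in `S`; the isomorphisms come for free by
  -- local fullness.
  have hθ (a) : Pseudoinverse (θ.toStrongTrans.app a) :=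
    { inv := ⟨(q a.val).inv, (hS a.val a.property).2⟩
      unit := SubSMC.isoMk (q a.val).unit
      counit := SubSMC.isoMk (q a.val).counit }
  exact ⟨⟨S.inclusion, J,
    -- The counit points towards the identity whereas `η` starts there, so `η` is inverted first.
    equivalenceOfPseudoinverse (invMonoidalTrans η hη) (fun a => (hη a).symm),
    equivalenceOfPseudoinverse θ hθ⟩, rfl⟩

end Biequivalence

/-!
### Strictification of a symmetric monoidal category
-/

/-- The objects of the strictification of `C`: lists of objects of `C`. -/
structure Strictification (C : Type u) : Type u where
  toList : List C

namespace Strictification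

open MonoidalCategory

section Monoidal

variable {C : Type u} [Category.{v} C] [MonoidalCategory C]

/-- The tensor product of a list of objects. -/
def prod : List C → C
  | [] => 𝟙_ C
  | x :: l => x ⊗ prod l

/-- The tensor product of a concatenation. -/
def prodAppend : ∀ l l' : List C, prod l ⊗ prod l' ≅ prod (l ++ l')
  | [], l' => λ_ (prod l')
  | x :: l, l' => α_ x (prod l) (prod l') ≪≫ whiskerLeftIso x (prodAppend l l')

theorem whiskerLeft_eqToHom_prod (x : C) {l l' : List C} (h : l = l') :
    x ◁ eqToHom (congrArg prod h) = eqToHom (congrArg (x ⊗ prod ·) h) := by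
  subst h
  simp

/-- Induction on `l`: the step is the pentagon with naturality of the associator. This is the
coherence that allows the associator of the strictification, transported from `C`, to be an
identity. -/
theorem prodAppend_associativity (l m n : List C) :
    (prodAppend l m).hom ▷ prod n ≫ (prodAppend (l ++ m) n).hom ≫
        eqToHom (congrArg prod (List.append_assoc l m n)) =
      (α_ _ _ _).hom ≫ prod l ◁ (prodAppend m n).hom ≫ (prodAppend l (m ++ n)).hom := by
  induction l with
  | nil => simp [prodAppend, prod]
  | cons x l ih =>
    have h := congrArg (x ◁ ·) ih
    simp only [MonoidalCategory.whiskerLeft_comp] at h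
    rw [whiskerLeft_eqToHom_prod x (List.append_assoc l m n)] at h
    change ((α_ _ _ _).hom ≫ x ◁ (prodAppend l m).hom) ▷ prod n ≫
      ((α_ x (prod (l ++ m)) (prod n)).hom ≫ x ◁ (prodAppend (l ++ m) n).hom) ≫
        eqToHom (congrArg (x ⊗ prod ·) (List.append_assoc l m n)) =
      (α_ (x ⊗ prod l) (prod m) (prod n)).hom ≫ (x ⊗ prod l) ◁ (prodAppend m n).hom ≫
        (α_ _ _ _).hom ≫ x ◁ (prodAppend l (m ++ n)).hom
    simp only [MonoidalCategory.comp_whiskerRight, Category.assoc,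
      associator_naturality_middle_assoc,
      associator_naturality_right_assoc]
    rw [h]
    simp

/-- The right unit counterpart, resting on `λ_ = ρ_` at the unit. The left unit needs no such lemma,
as `[] ++ l` reduces to `l`. -/
theorem prodAppend_nil (l : List C) :
    (prodAppend l []).hom ≫ eqToHom (congrArg prod (List.append_nil l)) = (ρ_ (prod l)).hom := by
  induction l with
  | nil => simp [prodAppend, prod, unitors_equal]
  | cons x l ih =>
    have h := congrArg (x ◁ ·) ih
    simp only [MonoidalCategory.whiskerLeft_comp] at h
    rw [whiskerLeft_eqToHom_prod x (List.append_nil l)] at h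
    change ((α_ _ _ _).hom ≫ x ◁ (prodAppend l []).hom) ≫
      eqToHom (congrArg (x ⊗ prod ·) (List.append_nil l)) = (ρ_ (x ⊗ prod l)).hom
    rw [Category.assoc, h]
    simp [prod]

/-- Morphisms are borrowed from `C` along `prod`, so `comparison` is fully faithful by construction
while the objects are free to carry a strictly associative product. -/
instance : Category (Strictification C) where
  Hom x y := prod x.toList ⟶ prod y.toList
  id x := 𝟙 (prod x.toList)
  comp f g := CategoryStruct.comp (obj := C) f g
  id_comp f := Category.id_comp (obj := C) f
  comp_id f := Category.comp_id (obj := C) f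
  assoc f g h := Category.assoc (obj := C) f g h

variable (C) in
/-- The comparison with the original category. -/
def comparison : Strictification C ⥤ C where
  obj x := prod x.toList
  map f := f

variable (C) in
/-- The functor sending an object to the one-element list. -/
def singleton : C ⥤ Strictification C where
  obj x := ⟨[x]⟩
  map {x y} f := (f ▷ 𝟙_ C : x ⊗ 𝟙_ C ⟶ y ⊗ 𝟙_ C)
  map_id x := id_whiskerRight x (𝟙_ C)
  map_comp f g := comp_whiskerRight f g (𝟙_ C)

variable (C) in
/-- The one-element list of `x` has tensor product `x`. -/
def singletonComparison : 𝟭 C ≅ singleton C ⋙ comparison C :=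
  NatIso.ofComponents (fun x => (ρ_ x).symm) (fun f => rightUnitor_inv_naturality f)

instance : (comparison C).Full := ⟨fun f => ⟨f, rfl⟩⟩

instance : (comparison C).Faithful := ⟨fun h => h⟩

/-- The constraints are equalities of lists. Morphisms are conjugated by `prodAppend`, as they must
be for it to be the structure morphism of `comparison`. -/
instance : MonoidalCategoryStruct (Strictification C) where
  tensorObj x y := ⟨x.toList ++ y.toList⟩
  whiskerLeft x y y' f := CategoryStruct.comp (obj := C) (prodAppend x.toList y.toList).inv
    (CategoryStruct.comp (obj := C) (MonoidalCategoryStruct.whiskerLeft (C := C) (prod x.toList) f)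
      (prodAppend x.toList y'.toList).hom)
  whiskerRight {x x'} f y := CategoryStruct.comp (obj := C) (prodAppend x.toList y.toList).inv
    (CategoryStruct.comp (obj := C) (MonoidalCategoryStruct.whiskerRight (C := C) f (prod y.toList))
      (prodAppend x'.toList y.toList).hom)
  tensorHom {x x' y y'} f g := CategoryStruct.comp (obj := C) (prodAppend x.toList y.toList).inv
    (CategoryStruct.comp (obj := C) (MonoidalCategoryStruct.tensorHom (C := C) f g)
      (prodAppend x'.toList y'.toList).hom)
  tensorUnit := ⟨[]⟩
  associator x y z := eqToIso (congrArg mk (List.append_assoc x.toList y.toList z.toList))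
  leftUnitor x := eqToIso (congrArg mk (List.nil_append x.toList))
  rightUnitor x := eqToIso (congrArg mk (List.append_nil x.toList))

variable (C) in
/-- The monoidal structure of the strictification is induced by the comparison. -/
def comparisonData : Monoidal.InducingFunctorData (comparison C) where
  μIso x y := prodAppend x.toList y.toList
  whiskerLeft_eq _ _ _ _ := rfl
  whiskerRight_eq _ _ := rfl
  tensorHom_eq _ _ := rfl
  εIso := Iso.refl (𝟙_ C)
  associator_eq x y z := by
    have h := prodAppend_associativity x.toList y.toList z.toList
    refine (eqToHom_map (comparison C)
      (congrArg mk (List.append_assoc x.toList y.toList z.toList))).trans ?_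
    change eqToHom (congrArg prod (List.append_assoc x.toList y.toList z.toList)) =
      ((prodAppend (x.toList ++ y.toList) z.toList).inv ≫
        ((prodAppend x.toList y.toList).inv ⊗ₘ 𝟙 (prod z.toList))) ≫ (α_ _ _ _).hom ≫
        (𝟙 _ ⊗ₘ (prodAppend y.toList z.toList).hom) ≫
          (prodAppend x.toList (y.toList ++ z.toList)).hom
    rw [tensorHom_id, id_tensorHom, ← h]
    simp
  leftUnitor_eq x := by
    change 𝟙 (prod x.toList) =
      ((λ_ (prod x.toList)).inv ≫ (𝟙 (𝟙_ C) ⊗ₘ 𝟙 (prod x.toList))) ≫ (λ_ (prod x.toList)).hom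
    simp
  rightUnitor_eq x := by
    refine (eqToHom_map (comparison C) (congrArg mk (List.append_nil x.toList))).trans ?_
    change eqToHom (congrArg prod (List.append_nil x.toList)) =
      ((prodAppend x.toList []).inv ≫ (𝟙 (prod x.toList) ⊗ₘ 𝟙 (prod []))) ≫ (ρ_ (prod x.toList)).hom
    rw [← prodAppend_nil]
    simp

instance : MonoidalCategory (Strictification C) :=
  Monoidal.induced (comparison C) (comparisonData C)

instance : (comparison C).Monoidal :=
  (Monoidal.fromInducedCoreMonoidal (comparison C) (comparisonData C)).toMonoidal

end Monoidal

variable {C : Type u} [Category.{v} C] [MonoidalCategory C] [SymmetricCategory C]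

/-- The symmetry is pulled back from `C`; permutative categories are not required to have a strict
one. -/
noncomputable instance : BraidedCategory (Strictification C) :=
  .ofFullyFaithful (comparison C)

noncomputable instance : (comparison C).Braided where
  braided x y := by
    change _ ≫ (comparison C).map ((comparison C).preimageIso _).hom = _
    simp

noncomputable instance : SymmetricCategory (Strictification C) :=
  .ofFaithful (comparison C)

/-- Followed by the fully faithful `comparison`, this functor is isomorphic to the identity, so the
structure lifts. Its unit constraint goes from `[]` to `[𝟙_ C]` and is not an identity. -/
noncomputable instance : (singleton C).Braided :=
  FullyFaithfulLift.braided (singletonComparison C)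

instance : NatTrans.IsMonoidal (singletonComparison C).hom :=
  FullyFaithfulLift.isMonoidal (singletonComparison C)

variable (C) in
/-- An object of the strictification is isomorphic to the one-element list of its tensor product. -/
noncomputable def comparisonSingleton : comparison C ⋙ singleton C ≅ 𝟭 (Strictification C) :=
  NatIso.ofComponents
    (fun x => (comparison C).preimageIso ((singletonComparison C).symm.app ((comparison C).obj x)))
    (fun f => (comparison C).map_injective (by
      simpa using (singletonComparison C).inv.naturality ((comparison C).map f)))

instance : NatTrans.IsMonoidal (comparisonSingleton C).hom :=
  isMonoidal_of_map_app _ (comparison C)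
    ((Functor.associator (comparison C) (singleton C) (comparison C)).hom ≫
      Functor.whiskerLeft (comparison C) (singletonComparison C).inv ≫
      (comparison C).rightUnitor.hom ≫ (comparison C).leftUnitor.inv)
    (fun x => by simp [comparisonSingleton])

end Strictification

/-! ### Strictifying objects and 1-cells of `SymMon` -/

section Inclusion

open SMC MonoidalCategory Functor.LaxMonoidal Functor.OplaxMonoidal

/-- The strictification of a symmetric monoidal category. -/
noncomputable abbrev strictify (P : SymMon.{v, u}) : SymMon.{v, u} := ⟨Strictification P.carrier⟩

theorem isPermutative_strictify (P : SymMon.{v, u}) : IsPermutative (strictify P) where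
  tensor_assoc _ _ _ := congrArg Strictification.mk (List.append_assoc _ _ _)
  unit_tensor _ := congrArg Strictification.mk (List.nil_append _)
  tensor_unit _ := congrArg Strictification.mk (List.append_nil _)
  associator_hom _ _ _ := rfl
  leftUnitor_hom _ := rfl
  rightUnitor_hom _ := rfl

/-- The equivalence from a symmetric monoidal category to its strictification. -/
noncomputable def toStrictify (P : SymMon.{v, u}) : P ⟶ strictify P :=
  SymMon.Hom.mk (Q := strictify P) (Strictification.singleton P.carrier)

/-- The equivalence from the strictification of a symmetric monoidal category. -/
noncomputable def fromStrictify (P : SymMon.{v, u}) : strictify P ⟶ P :=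
  SymMon.Hom.mk (P := strictify P) (Strictification.comparison P.carrier)

/-- A symmetric monoidal category is equivalent to its strictification. -/
noncomputable def toStrictifyPseudoinverse (P : SymMon.{v, u}) : Pseudoinverse (toStrictify P) where
  inv := fromStrictify P
  unit := SymMon.isoMk (F := toStrictify P ≫ fromStrictify P) (G := 𝟙 P)
    (Strictification.singletonComparison P.carrier).symm
    (inferInstanceAs (NatTrans.IsMonoidal (Strictification.singletonComparison P.carrier).inv))
  counit := SymMon.isoMk (F := fromStrictify P ≫ toStrictify P) (G := 𝟙 (strictify P))
    (Strictification.comparisonSingleton P.carrier)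
    (inferInstanceAs (NatTrans.IsMonoidal (Strictification.comparisonSingleton P.carrier).hom))

/-- A symmetric strong monoidal functor is isomorphic to a strictly unital one. -/
theorem exists_isStrictlyUnital {P Q : SymMon.{v, u}} (F : P ⟶ Q) :
    ∃ G : P ⟶ Q, IsStrictlyUnital G ∧ Nonempty (F ≅ G) := by
  classical
  -- Only the value at the unit object is changed, to `𝟙_`; the unit constraint of `F` supplies the
  -- isomorphism there, and the structure of `F` is then transported along `i`.
  let o (x : P.carrier) : Q.carrier := if x = 𝟙_ _ then 𝟙_ _ else F.functor.obj x
  let e (x : P.carrier) : F.functor.obj x ≅ o x :=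
    if h : x = 𝟙_ _ then F.functor.mapIso (eqToIso h) ≪≫ (Functor.Monoidal.εIso F.functor).symm ≪≫
      eqToIso (if_pos h).symm else eqToIso (if_neg h).symm
  let i := F.functor.isoCopyObj o e
  let _ : (F.functor.copyObj o e).Monoidal := Functor.Monoidal.transport i
  have hi : NatTrans.IsMonoidal i.hom :=
    { unit := (Functor.Monoidal.transport_ε i).symm
      tensor x y := by simp [Functor.Monoidal.transport_μ i] }
  let _ : (F.functor.copyObj o e).Braided :=
    { braided x y := by
        rw [← cancel_epi (i.hom.app x ⊗ₘ i.hom.app y), ← hi.tensor_assoc, ← i.hom.naturality,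
          Functor.LaxBraided.braided_assoc, hi.tensor]
        simp }
  refine ⟨⟨F.functor.copyObj o e⟩, ⟨(if_pos rfl).symm, ?_⟩, ⟨SymMon.isoMk i hi⟩⟩
  change ε (F.functor.copyObj o e) = _
  -- The transported unit constraint is `ε F` followed by `e` at the unit object, which is the
  -- inverse of `ε F` up to equalities of objects; the two cancel.
  rw [← hi.unit]
  change ε F.functor ≫ (e _).hom = _
  simp [e]
  rfl

end Inclusion

theorem corollary6p3 :
    ∃ e : SMC.Biequivalence SMC.PermU.{v, u} SMC.SymMon.{v, u}, e.functor = SMC.inclusion := by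
  refine exists_biequivalence_inclusion SMC.permUData.{v, u} (fun P => ?_)
    (fun F _ _ => exists_isStrictlyUnital F)
  -- A permutative category must be replaced through strictly unital functors, hence by itself along
  -- the identity. Elsewhere this condition is void and the strictification serves.
  by_cases hP : SMC.IsPermutative P
  · exact ⟨⟨P, hP⟩, 𝟙 P, ⟨𝟙 P, Bicategory.leftUnitor _, Bicategory.leftUnitor _⟩,
      fun _ => ⟨⟨rfl, rfl⟩, ⟨rfl, rfl⟩⟩⟩
  · exact ⟨⟨strictify P, isPermutative_strictify P⟩, toStrictify P,
      toStrictifyPseudoinverse P, fun h => absurd h hP⟩
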